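/- Let $\mathcal O_K$ be a discrete valuation ring with field of fractions $K$, normalized valuation $v_K$ and uniformizing element $\pi$. Let $L/K$ be a finite Galois extension with group $G$, let $\mathcal O_L$ be the integral closure of $\mathcal O_K$ in $L$ (a semi-local principal ideal domain), let $\mathfrak p$ be a maximal ideal of $\mathcal O_L$, let $v_L$ be the normalized valuation at $\mathfrak p$, let $e_{L/K}$ be the ramification index of $\mathfrak p$ over $\mathcal O_K$, and let $v_L(\mathfrak D_{L/K})$ be the exponent at $\mathfrak p$ of the different $\mathfrak D_{L/K}$ of $\mathcal O_L/\mathcal O_K$; put $v_K(\mathfrak D_{L/K})=v_L(\mathfrak D_{L/K})/e_{L/K}$. No perfectness of the residue field is assumed. For an elliptic curve $E$ over the field of fractions of a principal ideal domain $R$, a Weierstrass model of $E$ over $R$ is a Weierstrass equation with coefficients in $R$ together with an isomorphism of its generic fibre with $E$ that preserves the origin; it is minimal if the ideal generated by its discriminant $\Delta$ is the largest possible. For such a model with coordinates $x,y$ and zero section $\epsilon$, let $L(2\epsilon)=R\oplus Rx$ and $L(3\epsilon)=R\oplus Rx\oplus Ry$ (functions on $E$ minus its origin). A Weierstrass basis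 of the model is a triple $\{1,w,z\}$ such that $\{1,w\}$ is a basis of $L(2\epsilon)$, $\{1,w,z\}$ is a basis of $L(3\epsilon)$, and $w,z$ satisfy a Weierstrass equation $z^2+a_1wz+a_3z=w^3+a_2w^2+a_4w+a_6$ with $a_i\in R$. Let $E$ be an elliptic curve over $K$, let $\mathcal W$ be the minimal Weierstrass model of $E$ over $\mathcal O_K$, with zero section $\epsilon$, and let $\mathcal W'$ be the minimal Weierstrass model of $E_L$ over $\mathcal O_L$, with zero section $\epsilon'$. The group $G$ acts on functions on $E_L=E\times_K L$ through its action on $L$. Then the following hold. (i) $0\le v_L(\Delta(\mathcal W))-v_L(\Delta(\mathcal W'))\le 12\,(v_L(\mathfrak D_{L/K})+e_{L/K}-1)$. (ii) If $\{1,x,y\}$ is a Weierstrass basis of $\mathcal W$ and $\{1,x',y'\}$ is a Weierstrass basis of $\mathcal W'$, then $x=b_1x'+b_2$ and $y=b_3y'+b_4x'+b_5$ with $b_i\in\mathcal O_L$, $b_1,b_3\neq 0$, and $$v_L(b_1)\le 2\,(v_L(\mathfrak D_{L/K})+e_{L/K}-1),\qquad v_L(b_3)\le 3\,(v_L(\mathfrak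 D_{L/K})+e_{L/K}-1).$$ (iii) $L(2\epsilon)\subseteq L(2\epsilon')^G$ and $L(3\epsilon)\subseteq L(3\epsilon')^G$, and the $\mathcal O_K$-modules $L(2\epsilon')^G/L(2\epsilon)$ and $L(3\epsilon')^G/L(3\epsilon)$ are annihilated by $\pi^{2\lfloor v_K(\mathfrak D_{L/K})\rfloor+3}$ and $\pi^{2\lfloor v_K(\mathfrak D_{L/K})\rfloor+4}$ respectively. (iv) If $E_L$ has good reduction over $\mathcal O_L$ (that is, $\Delta(\mathcal W')$ is a unit of $\mathcal O_L$), then $$v_K(\Delta(\mathcal W))\le \left\lfloor \frac{12\,(v_L(\mathfrak D_{L/K})-1)}{e_{L/K}}\right\rfloor+12 .$$ -/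

import Mathlib

open Polynomial

noncomputable section

/-- The order `v_𝔭(a)` of a nonzero element `a` of a Dedekind domain at a nonzero prime `𝔭`: the
exponent of `𝔭` in the factorization of the ideal `(a)`. (Only used for `a ≠ 0`.) -/
def ordAt {R : Type*} [CommRing R] (p : Ideal R) (a : R) : ℕ :=
  multiplicity p (Ideal.span {a})

/-- The exponent of the different ideal `𝔇_{B/A}` at a prime `𝔭` of `B`. -/
def differentExponent (A : Type*) {B : Type*} [CommRing A] [CommRing B] [Algebra A B] [IsDomain A]
    [IsDedekindDomain B] [Module.IsTorsionFree A B] (p : Ideal B) : ℕ :=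
  multiplicity p (differentIdeal A B)

/-- A Weierstrass model over `R` of a curve `E` over `K = Frac R`: a Weierstrass equation with
coefficients in `R`, together with an isomorphism of its generic fibre with `E` (fixing the
origin), that is, a change of coordinates over `K`. -/
structure WeierstrassModel (R : Type*) {K : Type*} [CommRing R] [Field K] [Algebra R K]
    (E : WeierstrassCurve K) where
  /-- the Weierstrass equation over `R` -/
  eqn : WeierstrassCurve R
  /-- the change of coordinates from `E` to the generic fibre -/
  change : WeierstrassCurve.VariableChange K
  change_smul : change • E = eqn.map (algebraMap R K)

namespace WeierstrassModel

variable {R K : Type*} [CommRing R] [Field K] [Algebra R K] {E : WeierstrassCurve K}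

/-- A Weierstrass model is minimal if the ideal generated by its discriminant is the biggest
possible among all Weierstrass models of `E` over `R`. -/
def IsMinimal (W : WeierstrassModel R E) : Prop :=
  ∀ Z : WeierstrassModel R E, Ideal.span {Z.eqn.Δ} ≤ Ideal.span {W.eqn.Δ}

/-- The coordinate `x` of the equation of `W`, as a function on `E` minus its origin: if `X, Y` are
the coordinates of `E`, then `X = u² x + r` and `Y = u³ y + u² s x + t`. -/
def x (W : WeierstrassModel R E) : E.toAffine.CoordinateRing :=
  WeierstrassCurve.Affine.CoordinateRing.mk E.toAffine
    (C (C ((W.change.u⁻¹ : Kˣ) ^ 2 : K) * (X - C W.change.r)))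

/-- The coordinate `y` of the equation of `W`, as a function on `E` minus its origin. -/
def y (W : WeierstrassModel R E) : E.toAffine.CoordinateRing :=
  WeierstrassCurve.Affine.CoordinateRing.mk E.toAffine
    (C (C ((W.change.u⁻¹ : Kˣ) ^ 3 : K)) *
      (X - C (C W.change.s * (X - C W.change.r) + C W.change.t)))

/-- `L(2ε)`: the global sections on the model of the sheaf of functions with at most a double pole
along the zero section `ε`; it is the `R`-module with basis `1, x`. -/
def L2 (W : WeierstrassModel R E) : Submodule R E.toAffine.CoordinateRing :=
  Submodule.span R {1, W.x}

/-- `L(3ε)`: the global sections on the model of the sheaf of functions with at most a triple pole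
along the zero section `ε`; it is the `R`-module with basis `1, x, y`. -/
def L3 (W : WeierstrassModel R E) : Submodule R E.toAffine.CoordinateRing :=
  Submodule.span R {1, W.x, W.y}

/-- `{1, w, z}` is a Weierstrass basis of `W`: `{1, w}` is a basis of `L(2ε)`, `{1, w, z}` is a
basis of `L(3ε)`, and `w, z` satisfy a Weierstrass equation over `R`. (As `L(2ε)` and `L(3ε)` are
free of ranks two and three, it is enough to ask that these elements generate.) -/
def IsWeierstrassBasis (W : WeierstrassModel R E) (w z : E.toAffine.CoordinateRing) : Prop :=
  Submodule.span R {1, w} = W.L2 ∧ Submodule.span R {1, w, z} = W.L3 ∧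
    ∃ a₁ a₂ a₃ a₄ a₆ : R,
      z ^ 2 + a₁ • (w * z) + a₃ • z =
        w ^ 3 + a₂ • w ^ 2 + a₄ • w + a₆ • (1 : E.toAffine.CoordinateRing)

end WeierstrassModel

section Galois

variable {K L : Type*} [Field K] [Field L] [Algebra K L]

/-- Pullback of functions along `E_L → E`. -/
def pullback (L : Type*) [Field L] [Algebra K L] (E : WeierstrassCurve K) :
    E.toAffine.CoordinateRing →+* (E.map (algebraMap K L)).toAffine.CoordinateRing :=
  WeierstrassCurve.Affine.CoordinateRing.map E.toAffine (algebraMap K L)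

theorem map_galois_polynomial (E : WeierstrassCurve K) (σ : L ≃ₐ[K] L) :
    (E.map (algebraMap K L)).toAffine.polynomial.map (mapRingHom (σ : L →+* L)) =
      (E.map (algebraMap K L)).toAffine.polynomial := by
  rw [← WeierstrassCurve.Affine.map_polynomial]
  congr 1
  ext <;> simp

/-- The semi-linear action of `σ ∈ Gal(L/K)` on the functions on `E_L` minus its origin: it acts on
the coefficients in `L` and fixes the coordinate functions `X` and `Y` of `E`. -/
def galoisAct (E : WeierstrassCurve K) (σ : L ≃ₐ[K] L) :
    (E.map (algebraMap K L)).toAffine.CoordinateRing →+*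
      (E.map (algebraMap K L)).toAffine.CoordinateRing :=
  AdjoinRoot.map (mapRingHom (σ : L →+* L)) _ _ (map_galois_polynomial E σ).symm.dvd

/-- The elements of an `S`-module `N` of functions on `E_L` that are invariant under
`Gal(L/K)`. -/
def galoisInvariants {S : Type*} [CommRing S] [Algebra S L] (E : WeierstrassCurve K)
    (N : Submodule S (E.map (algebraMap K L)).toAffine.CoordinateRing) :
    Set (E.map (algebraMap K L)).toAffine.CoordinateRing :=
  {f | f ∈ N ∧ ∀ σ : L ≃ₐ[K] L, galoisAct E σ f = f}

end Galois

end

/-! The base change of `W` and the model `W'` are related by a substitution x = v²x' + ρ, y = v³y' +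
v²στx-free form aside: y = v³y' + v²σx' + τ. Minimality of `W'` makes v, ρ, σ, τ integral
(`exists_integral_transition`), and Δ(W) = v¹²Δ(W'). The heart of the matter is a bound for n =
ord_p(v) in terms of the exponent d of the different and the ramification index e.

Every Galois conjugate of `W'` is again minimal, so the substitution differs from its conjugates
only by invertible integral substitutions (`IsGaloisCompatible`). In particular some positive power
of v is associated to a power of π, so divisibility between powers of v and of π can be read at the
single prime p (`dvd_of_ordAt_le`).

If π divides v and the substitution factors as one over K with scaling factor π followed by an
integral one, the intermediate curve has coefficients that lie in K and are integral, so it is a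
model of E with discriminant Δ(W)/π¹². This contradicts minimality of `W` (`not_approximates`). Such
a factorization exists when v is large: write v = πm. If n > d, then 1/v is outside the codifferent,
so some b/m has trace one (`exists_trace_mul_eq_one`), and averaging ρ, σ and σρ - τ against it
produces elements of K close to ρ, σ, τ (`exists_approximates`). Hence n < d + e, and (i), (ii) and
(iv) follow from the orders 12n, 2n and 3n.

For (iii), an invariant function is γy + αx + β with γ, α, β in K. In L(2ε') one has γ = 0 and αv²
integral, and the bound on n suffices. In L(3ε') the integrality of γv³ alone would only give the
exponent 3q + 5, where q = ⌊d/e⌋. If π^(2q+4)γ were not integral, v would be large enough to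
approximate ρ modulo π² by averaging with denominator m², and the invariant function divided by γ
would itself supply the approximations of σ and τ, contradicting minimality again
(`exists_pow_mul_eq`). -/

/-! ### Orders at a prime of a Dedekind domain. -/

theorem ordAt_mul {R : Type*} [CommRing R] [IsDedekindDomain R] {p : Ideal R} [hp : p.IsPrime]
    (hp0 : p ≠ ⊥) {a b : R} (ha : a ≠ 0) (hb : b ≠ 0) :
    ordAt p (a * b) = ordAt p a + ordAt p b := by
  have hprime : Prime p := Ideal.prime_of_isPrime hp0 hp
  unfold ordAt
  rw [← Ideal.span_singleton_mul_span_singleton]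
  apply multiplicity_mul hprime
  apply FiniteMultiplicity.of_prime_left hprime
  rw [Ideal.span_singleton_mul_span_singleton]
  simpa using ⟨ha, hb⟩

theorem ordAt_of_isUnit {R : Type*} [CommRing R] {p : Ideal R} [hp : p.IsPrime]
    {a : R} (ha : IsUnit a) : ordAt p a = 0 := by
  unfold ordAt
  rw [Ideal.span_singleton_eq_top.mpr ha, multiplicity_eq_zero]
  exact fun h ↦ hp.ne_top (top_le_iff.mp (Ideal.le_of_dvd h))

theorem ordAt_pow {R : Type*} [CommRing R] [IsDedekindDomain R] {p : Ideal R} [hp : p.IsPrime]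
    (hp0 : p ≠ ⊥) {a : R} (ha : a ≠ 0) (k : ℕ) : ordAt p (a ^ k) = k * ordAt p a := by
  induction k with
  | zero => simpa using ordAt_of_isUnit isUnit_one
  | succ k ih => rw [pow_succ, ordAt_mul hp0 (pow_ne_zero _ ha) ha, ih]; ring

theorem ordAt_le_of_dvd {R : Type*} [CommRing R] [IsDedekindDomain R] {p : Ideal R}
    [hp : p.IsPrime] (hp0 : p ≠ ⊥) {a b : R} (hb : b ≠ 0) (h : a ∣ b) :
    ordAt p a ≤ ordAt p b := by
  obtain ⟨c, rfl⟩ := h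
  rw [ordAt_mul hp0 (left_ne_zero_of_mul hb) (right_ne_zero_of_mul hb)]
  exact Nat.le_add_right _ _

/-- If `a` divides every element of `c I`, then the order of `a` is at most that of `c I`. -/
theorem ordAt_le_multiplicity_add {R : Type*} [CommRing R] [IsDedekindDomain R] {p : Ideal R}
    [hp : p.IsPrime] (hp0 : p ≠ ⊥) {I : Ideal R} (hI : I ≠ ⊥) {a c : R} (hc : c ≠ 0)
    (h : ∀ d ∈ I, a ∣ d * c) : ordAt p a ≤ multiplicity p I + ordAt p c := by
  have hprime : Prime p := Ideal.prime_of_isPrime hp0 hp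
  have hne : I * Ideal.span {c} ≠ 0 := mul_ne_zero hI (by simpa using hc)
  have hfin : FiniteMultiplicity p (I * Ideal.span {c}) :=
    FiniteMultiplicity.of_prime_left hprime hne
  unfold ordAt
  rw [← multiplicity_mul hprime hfin]
  refine hfin.le_multiplicity_of_pow_dvd
    ((pow_multiplicity_dvd _ _).trans (Ideal.dvd_iff_le.mpr ?_))
  rw [Ideal.mul_le]
  intro r hr s hs
  obtain ⟨t, rfl⟩ := Ideal.mem_span_singleton'.mp hs
  obtain ⟨k, hk⟩ := h r hr
  exact Ideal.mem_span_singleton'.mpr ⟨t * k, by linear_combination -t * hk⟩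

/-! ### Integrality of changes of coordinates between integral equations. -/

namespace WeierstrassCurve

section Integrality

variable {R F : Type*} [CommRing R] [CommRing F] [Algebra R F]

theorem isIntegral_of_quadratic {x : F} (a b : R)
    (h : x ^ 2 + algebraMap R F a * x + algebraMap R F b = 0) : _root_.IsIntegral R x :=
  ⟨X ^ 2 + C a * X + C b, by monicity!, by simpa using h⟩

variable {A B : WeierstrassCurve R} {D : VariableChange F}

/-- A change of variables between integral Weierstrass equations whose scaling factor is integral
has an integral translation `r`. -/
theorem isIntegral_variableChange_r
    (h : D • A.map (algebraMap R F) = B.map (algebraMap R F)) (u : R)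
    (hu : algebraMap R F u = D.u) : _root_.IsIntegral R D.r := by
  have hui : algebraMap R F u * (D.u⁻¹ : Fˣ) = 1 := by rw [hu]; exact D.u.mul_inv
  have e6 := congrArg b₆ h
  have e8 := congrArg b₈ h
  rw [variableChange_b₆] at e6
  rw [variableChange_b₈] at e8
  simp only [map_b₂, map_b₄, map_b₆, map_b₈] at e6 e8
  have h6 : algebraMap R F u ^ 6 * algebraMap R F B.b₆ = algebraMap R F A.b₆ +
      2 * D.r * algebraMap R F A.b₄ + D.r ^ 2 * algebraMap R F A.b₂ + 4 * D.r ^ 3 := by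
    rw [← e6, ← mul_assoc, ← mul_pow, hui, one_pow, one_mul]
  have h8 : algebraMap R F u ^ 8 * algebraMap R F B.b₈ = algebraMap R F A.b₈ +
      3 * D.r * algebraMap R F A.b₆ + 3 * D.r ^ 2 * algebraMap R F A.b₄ +
      D.r ^ 3 * algebraMap R F A.b₂ + 3 * D.r ^ 4 := by
    rw [← e8, ← mul_assoc, ← mul_pow, hui, one_pow, one_mul]
  -- The formulas for b₆ and b₈ have leading terms 4r³ and 3r⁴. Scaling by 16 and 27 makes them
  -- monic in 4r and 3r, and the difference of these is r, so no assumption on the residue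
  -- characteristic is needed.
  have i4 : _root_.IsIntegral R (4 * D.r) :=
    ⟨X ^ 3 + C A.b₂ * X ^ 2 + C (8 * A.b₄) * X + C (16 * (A.b₆ - u ^ 6 * B.b₆)), by monicity!, by
      simp only [eval₂_add, eval₂_mul, eval₂_pow, eval₂_X, eval₂_C]
      simp only [map_mul, map_sub, map_pow, map_ofNat]
      linear_combination -16 * h6⟩
  have i3 : _root_.IsIntegral R (3 * D.r) :=
    ⟨X ^ 4 + C A.b₂ * X ^ 3 + C (9 * A.b₄) * X ^ 2 + C (27 * A.b₆) * X +
      C (27 * (A.b₈ - u ^ 8 * B.b₈)), by monicity!, by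
      simp only [eval₂_add, eval₂_mul, eval₂_pow, eval₂_X, eval₂_C]
      simp only [map_mul, map_sub, map_pow, map_ofNat]
      linear_combination -27 * h8⟩
  have := i4.sub i3
  rwa [show 4 * D.r - 3 * D.r = D.r by ring] at this

/-- Once u and r are integral, the transformation formula for a₂ is a monic quadratic equation for
s; the one for a₆ plays the same role for t below. -/
theorem isIntegral_variableChange_s
    (h : D • A.map (algebraMap R F) = B.map (algebraMap R F)) (u r : R)
    (hu : algebraMap R F u = D.u) (hr : algebraMap R F r = D.r) : _root_.IsIntegral R D.s := by
  have hui : algebraMap R F u * (D.u⁻¹ : Fˣ) = 1 := by rw [hu]; exact D.u.mul_inv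
  have e := congrArg a₂ h
  rw [variableChange_a₂] at e
  simp only [map_a₁, map_a₂, ← hr] at e
  have e' : algebraMap R F u ^ 2 * algebraMap R F B.a₂ = algebraMap R F A.a₂ -
      D.s * algebraMap R F A.a₁ + 3 * algebraMap R F r - D.s ^ 2 := by
    rw [← e, ← mul_assoc, ← mul_pow, hui, one_pow, one_mul]
  refine isIntegral_of_quadratic A.a₁ (u ^ 2 * B.a₂ - A.a₂ - 3 * r) ?_
  simp only [map_mul, map_sub, map_pow, map_ofNat]
  linear_combination e'

theorem isIntegral_variableChange_t
    (h : D • A.map (algebraMap R F) = B.map (algebraMap R F)) (u r : R)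
    (hu : algebraMap R F u = D.u) (hr : algebraMap R F r = D.r) : _root_.IsIntegral R D.t := by
  have hui : algebraMap R F u * (D.u⁻¹ : Fˣ) = 1 := by rw [hu]; exact D.u.mul_inv
  have e := congrArg a₆ h
  rw [variableChange_a₆] at e
  simp only [map_a₁, map_a₂, map_a₃, map_a₄, map_a₆, ← hr] at e
  have e' : algebraMap R F u ^ 6 * algebraMap R F B.a₆ = algebraMap R F A.a₆ +
      algebraMap R F r * algebraMap R F A.a₄ + algebraMap R F r ^ 2 * algebraMap R F A.a₂ +
      algebraMap R F r ^ 3 - D.t * algebraMap R F A.a₃ - D.t ^ 2 -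
      algebraMap R F r * D.t * algebraMap R F A.a₁ := by
    rw [← e, ← mul_assoc, ← mul_pow, hui, one_pow, one_mul]
  refine isIntegral_of_quadratic (A.a₃ + r * A.a₁)
    (u ^ 6 * B.a₆ - A.a₆ - r * A.a₄ - r ^ 2 * A.a₂ - r ^ 3) ?_
  simp only [map_mul, map_sub, map_add, map_pow]
  linear_combination e'

end Integrality

/-- The Weierstrass equation from which `A` is obtained by the substitution
`(X, Y) ↦ (m²X + r, m³Y + m²sX + t)`, where `m` need not be invertible. -/
def descend {R : Type*} [CommRing R] (A : WeierstrassCurve R) (m r s t : R) :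
    WeierstrassCurve R where
  a₁ := m * A.a₁ - 2 * s
  a₂ := m ^ 2 * A.a₂ + s * (m * A.a₁ - 2 * s) - 3 * r + s ^ 2
  a₃ := m ^ 3 * A.a₃ - r * (m * A.a₁ - 2 * s) - 2 * t
  a₄ := m ^ 4 * A.a₄ + s * (m ^ 3 * A.a₃ - r * (m * A.a₁ - 2 * s) - 2 * t)
    - 2 * r * (m ^ 2 * A.a₂ + s * (m * A.a₁ - 2 * s) - 3 * r + s ^ 2)
    + (t + r * s) * (m * A.a₁ - 2 * s) - 3 * r ^ 2 + 2 * s * t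
  a₆ := m ^ 6 * A.a₆ - r * (m ^ 4 * A.a₄ + s * (m ^ 3 * A.a₃ - r * (m * A.a₁ - 2 * s) - 2 * t)
    - 2 * r * (m ^ 2 * A.a₂ + s * (m * A.a₁ - 2 * s) - 3 * r + s ^ 2)
    + (t + r * s) * (m * A.a₁ - 2 * s) - 3 * r ^ 2 + 2 * s * t)
    - r ^ 2 * (m ^ 2 * A.a₂ + s * (m * A.a₁ - 2 * s) - 3 * r + s ^ 2) - r ^ 3
    + t * (m ^ 3 * A.a₃ - r * (m * A.a₁ - 2 * s) - 2 * t) + t ^ 2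
    + r * t * (m * A.a₁ - 2 * s)

/-- The coefficients of `descend` are polynomial in the data, obtained by solving the transformation
formulas successively for a₁, a₂, a₃, a₄, a₆. They therefore stay in `R` although the substitution
is invertible only over `F`. -/
theorem variableChange_smul_descend {R F : Type*} [CommRing R] [CommRing F] [Algebra R F]
    (A : WeierstrassCurve R) (m r s t : R) (H : VariableChange F)
    (hm : algebraMap R F m = H.u) (hr : algebraMap R F r = H.r) (hs : algebraMap R F s = H.s)
    (ht : algebraMap R F t = H.t) :
    H • (A.descend m r s t).map (algebraMap R F) = A.map (algebraMap R F) := by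
  have hu : (H.u⁻¹ : Fˣ) * algebraMap R F m = 1 := by rw [hm]; exact H.u.inv_mul
  have key (k : ℕ) (c : F) : ((H.u⁻¹ : Fˣ) : F) ^ k * (algebraMap R F m ^ k * c) = c := by
    rw [← mul_assoc, ← mul_pow, hu, one_pow, one_mul]
  ext
  · rw [variableChange_a₁, map_a₁, map_a₁, ← hs]
    conv_rhs => rw [← key 1 (algebraMap R F A.a₁)]
    simp only [descend, map_sub, map_mul, map_ofNat]
    ring
  · rw [variableChange_a₂, map_a₁, map_a₂, map_a₂, ← hs, ← hr]
    conv_rhs => rw [← key 2 (algebraMap R F A.a₂)]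
    simp only [descend, map_add, map_sub, map_mul, map_pow, map_ofNat]
    ring
  · rw [variableChange_a₃, map_a₁, map_a₃, map_a₃, ← hr, ← ht]
    conv_rhs => rw [← key 3 (algebraMap R F A.a₃)]
    simp only [descend, map_sub, map_mul, map_pow, map_ofNat]
    ring
  · rw [variableChange_a₄, map_a₁, map_a₂, map_a₃, map_a₄, map_a₄, ← hr, ← ht, ← hs]
    conv_rhs => rw [← key 4 (algebraMap R F A.a₄)]
    simp only [descend, map_add, map_sub, map_mul, map_pow, map_ofNat]
    ring
  · rw [variableChange_a₆, map_a₁, map_a₂, map_a₃, map_a₄, map_a₆, map_a₆, ← hr, ← ht]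
    conv_rhs => rw [← key 6 (algebraMap R F A.a₆)]
    simp only [descend, map_add, map_sub, map_mul, map_pow, map_ofNat]
    ring

end WeierstrassCurve

/-! ### Transitions between models and their Galois conjugates. -/

namespace WeierstrassModel

section Transition

variable {R K : Type*} [CommRing R] [Field K] [Algebra R K] {E : WeierstrassCurve K}

/-- The change of coordinates from the generic fibre of one model of `E` to that of another. -/
def transition (W Z : WeierstrassModel R E) : WeierstrassCurve.VariableChange K :=
  Z.change * W.change⁻¹

theorem transition_smul (W Z : WeierstrassModel R E) :
    W.transition Z • W.eqn.map (algebraMap R K) = Z.eqn.map (algebraMap R K) := by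
  rw [← W.change_smul, ← Z.change_smul, transition, smul_smul, inv_mul_cancel_right]

theorem transition_mul (W Z V : WeierstrassModel R E) :
    Z.transition V * W.transition Z = W.transition V := by
  simp only [transition]
  group

theorem transition_self (W : WeierstrassModel R E) : W.transition W = 1 := by
  simp [transition]

theorem algebraMap_Δ (W : WeierstrassModel R E) :
    algebraMap R K W.eqn.Δ = (W.change.u⁻¹ : Kˣ) ^ 12 * E.Δ := by
  rw [← WeierstrassCurve.map_Δ, ← W.change_smul, WeierstrassCurve.variableChange_Δ]

theorem Δ_ne_zero [E.IsElliptic] (W : WeierstrassModel R E) : W.eqn.Δ ≠ 0 := by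
  intro h
  have := W.algebraMap_Δ
  rw [h, map_zero] at this
  exact mul_ne_zero (pow_ne_zero _ (Units.ne_zero _)) E.isUnit_Δ.ne_zero this.symm

theorem algebraMap_Δ_transition (W Z : WeierstrassModel R E) :
    algebraMap R K W.eqn.Δ = ((W.transition Z).u : K) ^ 12 * algebraMap R K Z.eqn.Δ := by
  have h := congrArg WeierstrassCurve.Δ (W.transition_smul Z)
  rw [WeierstrassCurve.variableChange_Δ, WeierstrassCurve.map_Δ, WeierstrassCurve.map_Δ] at h
  rw [← h, ← mul_assoc, ← mul_pow, Units.mul_inv, one_pow, one_mul]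

/-- The change of coordinates from a model to a minimal model is integral. -/
theorem exists_integral_transition [IsDomain R] [IsIntegrallyClosed R] [IsFractionRing R K]
    [E.IsElliptic] (W Z : WeierstrassModel R E) (hZ : Z.IsMinimal) :
    ∃ u r s t : R, algebraMap R K u = (W.transition Z).u ∧
      algebraMap R K r = (W.transition Z).r ∧ algebraMap R K s = (W.transition Z).s ∧
      algebraMap R K t = (W.transition Z).t := by
  obtain ⟨c, hc⟩ := Ideal.mem_span_singleton'.mp (hZ W (Ideal.mem_span_singleton_self _))
  have hΔ : algebraMap R K Z.eqn.Δ ≠ 0 :=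
    (map_ne_zero_iff _ (IsFractionRing.injective R K)).mpr Z.Δ_ne_zero
  have hu : ((W.transition Z).u : K) ^ 12 = algebraMap R K c := by
    apply mul_right_cancel₀ hΔ
    rw [← algebraMap_Δ_transition, ← hc, map_mul]
  have hui : IsIntegral R ((W.transition Z).u : K) :=
    IsIntegral.of_pow (n := 12) (by norm_num) (hu ▸ isIntegral_algebraMap)
  obtain ⟨u, hu⟩ := IsIntegrallyClosed.isIntegral_iff.mp hui
  have h := W.transition_smul Z
  obtain ⟨r, hr⟩ := IsIntegrallyClosed.isIntegral_iff.mp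
    (WeierstrassCurve.isIntegral_variableChange_r h u hu)
  obtain ⟨s, hs⟩ := IsIntegrallyClosed.isIntegral_iff.mp
    (WeierstrassCurve.isIntegral_variableChange_s h u r hu hr)
  obtain ⟨t, ht⟩ := IsIntegrallyClosed.isIntegral_iff.mp
    (WeierstrassCurve.isIntegral_variableChange_t h u r hu hr)
  exact ⟨u, r, s, t, hu, hr, hs, ht⟩

end Transition

section Galois

variable {OK K OL L : Type*} [CommRing OK] [Field K] [Algebra OK K] [Field L] [Algebra K L]
  [CommRing OL] [Algebra OK OL] [Algebra OL L] [Algebra OK L]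
  [IsScalarTower OK K L] [IsScalarTower OK OL L] {E : WeierstrassCurve K}

/-- The base change to `OL` of a model over `OK`. -/
def baseChange (OL L : Type*) [Field L] [Algebra K L]
    [CommRing OL] [Algebra OK OL] [Algebra OL L] [Algebra OK L]
    [IsScalarTower OK K L] [IsScalarTower OK OL L] (W : WeierstrassModel OK E) :
    WeierstrassModel OL (E.map (algebraMap K L)) where
  eqn := W.eqn.map (algebraMap OK OL)
  change := W.change.map (algebraMap K L)
  change_smul := by
    rw [WeierstrassCurve.map_variableChange, W.change_smul, WeierstrassCurve.map_map,
      WeierstrassCurve.map_map, ← IsScalarTower.algebraMap_eq, ← IsScalarTower.algebraMap_eq]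

variable [IsFractionRing OK K] [FiniteDimensional K L] [IsIntegralClosure OL OK L]

variable (OK) in
/-- The conjugate by an automorphism of `L` over `K` of a model over `OL`. -/
noncomputable def conj (g : L ≃ₐ[K] L) (Z : WeierstrassModel OL (E.map (algebraMap K L))) :
    WeierstrassModel OL (E.map (algebraMap K L)) where
  eqn := Z.eqn.map (galRestrict OK K L OL g : OL →+* OL)
  change := Z.change.map (g : L →+* L)
  change_smul := by
    have hE : (E.map (algebraMap K L)).map (g : L →+* L) = E.map (algebraMap K L) := by
      ext <;> simp
    have h := WeierstrassCurve.map_variableChange (E.map (algebraMap K L)) Z.change (g : L →+* L)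
    rw [hE] at h
    rw [h, Z.change_smul, WeierstrassCurve.map_map, WeierstrassCurve.map_map]
    congr 1
    ext x
    simp [algebraMap_galRestrict_apply]

theorem conj_Δ (g : L ≃ₐ[K] L) (Z : WeierstrassModel OL (E.map (algebraMap K L))) :
    (Z.conj OK g).eqn.Δ = galRestrict OK K L OL g Z.eqn.Δ :=
  WeierstrassCurve.map_Δ _ _

/-- Conjugation by `g⁻¹` turns a competitor of the conjugate model into a competitor of the original
one; applying `g` to the resulting divisibility of discriminants gives the claim. -/
theorem IsMinimal.conj {W : WeierstrassModel OL (E.map (algebraMap K L))} (hW : W.IsMinimal)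
    (g : L ≃ₐ[K] L) : (W.conj OK g).IsMinimal := by
  intro Z
  rw [Ideal.span_singleton_le_iff_mem, Ideal.mem_span_singleton]
  have h := hW (Z.conj OK g⁻¹)
  rw [Ideal.span_singleton_le_iff_mem, Ideal.mem_span_singleton, conj_Δ] at h
  rw [conj_Δ]
  have h' := map_dvd (galRestrict OK K L OL g) h
  rwa [← AlgEquiv.mul_apply, ← map_mul, mul_inv_cancel, map_one, AlgEquiv.one_apply] at h'

/-- The change of coordinates defining the base change of `W` has coefficients in `K`, so only the
contribution of `W'` is moved by `g`. -/
theorem transition_baseChange_conj (W : WeierstrassModel OK E)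
    (W' : WeierstrassModel OL (E.map (algebraMap K L))) (g : L ≃ₐ[K] L) :
    (W.baseChange OL L).transition (W'.conj OK g) =
      ((W.baseChange OL L).transition W').map (g : L →+* L) := by
  have h := map_mul (WeierstrassCurve.VariableChange.mapHom (g : L →+* L)) W'.change
    (W.baseChange OL L).change⁻¹
  have h2 := map_inv (WeierstrassCurve.VariableChange.mapHom (g : L →+* L))
    (W.baseChange OL L).change
  have h3 : WeierstrassCurve.VariableChange.mapHom (g : L →+* L) (W.baseChange OL L).change =
      (W.baseChange OL L).change := by
    ext <;> simp [WeierstrassCurve.VariableChange.mapHom, baseChange]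
  rw [h2, h3] at h
  exact h.symm

end Galois

end WeierstrassModel

/-! ### Compatibility of the transition with the Galois group. -/

section Compatible

variable {OK K OL L : Type*} [CommRing OK] [Field K] [Algebra OK K]
  [IsFractionRing OK K] [Field L] [Algebra K L] [FiniteDimensional K L]
  [CommRing OL] [Algebra OK OL] [Algebra OL L] [Algebra OK L]
  [IsScalarTower OK K L] [IsScalarTower OK OL L] [IsIntegralClosure OL OK L]

variable (OK K OL L) in
/-- The change of coordinates `(X, Y) ↦ (v²X + ρ, v³Y + v²σX + τ)` is compatible with the Galois
group: it differs from each of its conjugates by an invertible integral change of coordinates. -/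
def IsGaloisCompatible (v ρ σ τ : OL) : Prop :=
  ∀ g : L ≃ₐ[K] L, ∃ (ε : OLˣ) (r s t : OL),
    galRestrict OK K L OL g v = ε * v ∧
    galRestrict OK K L OL g ρ = ρ + r * v ^ 2 ∧
    galRestrict OK K L OL g σ = σ + v * s ∧
    galRestrict OK K L OL g τ = τ + (t * v ^ 3 + r * σ * v ^ 2)

theorem WeierstrassModel.exists_galoisCompatible_transition [IsDomain OL] [IsIntegrallyClosed OL]
    [IsFractionRing OL L] {E : WeierstrassCurve K}
    [E.IsElliptic] (W : WeierstrassModel OK E)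
    (W' : WeierstrassModel OL (E.map (algebraMap K L))) (hW' : W'.IsMinimal) :
    ∃ v ρ σ τ : OL, algebraMap OL L v = ((W.baseChange OL L).transition W').u ∧
      algebraMap OL L ρ = ((W.baseChange OL L).transition W').r ∧
      algebraMap OL L σ = ((W.baseChange OL L).transition W').s ∧
      algebraMap OL L τ = ((W.baseChange OL L).transition W').t ∧
      IsGaloisCompatible OK K OL L v ρ σ τ := by
  have hinj := IsFractionRing.injective OL L
  obtain ⟨v, ρ, σ, τ, hv, hρ, hσ, hτ⟩ :=
    (W.baseChange OL L).exists_integral_transition W' hW'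
  refine ⟨v, ρ, σ, τ, hv, hρ, hσ, hτ, fun g ↦ ?_⟩
  obtain ⟨ε, r, s, t, hε, hr, hs, ht⟩ :=
    W'.exists_integral_transition (W'.conj OK g) (hW'.conj g)
  -- Both `W'` and its conjugate are minimal, so the transition is integral in either direction and
  -- its scaling factor is a unit.
  obtain ⟨ε', -, -, -, hε', -⟩ := (W'.conj OK g).exists_integral_transition W' hW'
  have hm1 := (W'.transition_mul (W'.conj OK g) W').trans W'.transition_self
  have hm2 := (W.baseChange OL L).transition_mul W' (W'.conj OK g)
  rw [W.transition_baseChange_conj] at hm2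
  have hunit : ε * ε' = 1 := by
    apply hinj
    have := congrArg (fun D : WeierstrassCurve.VariableChange L ↦ (D.u : L)) hm1
    simp only [WeierstrassCurve.VariableChange.mul_def, WeierstrassCurve.VariableChange.one_def,
      Units.val_mul, Units.val_one] at this
    rw [map_mul, hε, hε', map_one, mul_comm]
    exact this
  have e1 := congrArg (fun D : WeierstrassCurve.VariableChange L ↦ (D.u : L)) hm2
  have e2 := congrArg WeierstrassCurve.VariableChange.r hm2
  have e3 := congrArg WeierstrassCurve.VariableChange.s hm2
  have e4 := congrArg WeierstrassCurve.VariableChange.t hm2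
  simp only [WeierstrassCurve.VariableChange.mul_def, WeierstrassCurve.VariableChange.map,
    Units.val_mul, Units.coe_map, ← hv, ← hρ, ← hσ, ← hτ, ← hε, ← hr, ← hs, ← ht] at e1 e2 e3 e4
  refine ⟨Units.mkOfMulEqOne ε ε' hunit, r, s, t, hinj ?_, hinj ?_, hinj ?_, hinj ?_⟩ <;>
    rw [algebraMap_galRestrict_apply]
  · simpa using e1.symm
  · simp only [map_add, map_mul, map_pow]
    rw [add_comm]
    simpa using e2.symm
  · simp only [map_add, map_mul]
    rw [add_comm]
    simpa using e3.symm
  · simp only [map_add, map_mul, map_pow]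
    rw [add_comm]
    simpa using e4.symm

end Compatible

/-! ### Averaging, elements of trace one, and divisibility between v and π. -/

section Galois

variable {OK K OL L : Type*} [CommRing OK] [Field K] [Algebra OK K]
  [IsFractionRing OK K] [Field L] [Algebra K L] [FiniteDimensional K L]
  [CommRing OL] [Algebra OK OL] [Algebra OL L] [Algebra OK L]
  [IsScalarTower OK K L] [IsScalarTower OK OL L] [IsIntegralClosure OL OK L]

/-- Averaging against an element `b / m` of trace one, where `m` generates a Galois-stable ideal:
the average of `a` differs from `a` by a combination of the differences `g a - a`, divided by
`m`. -/
theorem exists_average [IsGalois K L] {m b : OL} (hm : algebraMap OL L m ≠ 0)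
    (hmg : ∀ g : L ≃ₐ[K] L, ∃ ε : OLˣ, galRestrict OK K L OL g m = ε * m)
    (hb : Algebra.trace K L (algebraMap OL L b * (algebraMap OL L m)⁻¹) = 1) :
    ∃ c : (L ≃ₐ[K] L) → OL, ∀ (a : OL) (k : (L ≃ₐ[K] L) → OL),
      (∀ g, galRestrict OK K L OL g a = a + k g) →
      ∃ r : K, algebraMap OL L m * algebraMap K L r =
        algebraMap OL L (m * a + ∑ g, c g * k g) := by
  choose ε hε using hmg
  -- This is m · g(b/m), which is integral because g(m) and m differ by a unit.
  let c (g : L ≃ₐ[K] L) : OL := galRestrict OK K L OL g b * (ε g)⁻¹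
  have hc (g : L ≃ₐ[K] L) : algebraMap OL L m * g (algebraMap OL L b * (algebraMap OL L m)⁻¹) =
      algebraMap OL L (c g) := by
    have hε0 : algebraMap OL L (ε g) * algebraMap OL L ((ε g)⁻¹ : OLˣ) = 1 := by
      rw [← map_mul, Units.mul_inv, map_one]
    have hε1 : algebraMap OL L (ε g) ≠ 0 := left_ne_zero_of_mul_eq_one hε0
    rw [map_mul, map_inv₀, ← algebraMap_galRestrict_apply OK, ← algebraMap_galRestrict_apply OK,
      hε, map_mul, map_mul, eq_inv_of_mul_eq_one_right hε0]
    field_simp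
  have hsum : ∑ g, algebraMap OL L (c g) = algebraMap OL L m := by
    have := trace_eq_sum_automorphisms (K := K) (algebraMap OL L b * (algebraMap OL L m)⁻¹)
    rw [hb, map_one] at this
    simp_rw [← hc, ← Finset.mul_sum]
    rw [← this, mul_one]
  -- The average is Tr((b/m)a). Its product with m is ∑ c(g) g(a), and ∑ c(g) = m because b/m has
  -- trace one.
  refine ⟨c, fun a k hk ↦ ⟨Algebra.trace K L (algebraMap OL L b * (algebraMap OL L m)⁻¹ *
    algebraMap OL L a), ?_⟩⟩
  rw [trace_eq_sum_automorphisms, Finset.mul_sum]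
  simp_rw [map_mul _ (algebraMap OL L b * (algebraMap OL L m)⁻¹), ← mul_assoc, hc,
    ← algebraMap_galRestrict_apply OK, hk, map_add, mul_add, Finset.sum_add_distrib,
    ← Finset.sum_mul, hsum, map_sum, map_mul]

variable [IsDomain OK]

theorem IsGaloisCompatible.exists_unit_of_eq_mul [IsDomain OL] [Module.IsTorsionFree OK OL]
    {v ρ σ τ : OL} (h : IsGaloisCompatible OK K OL L v ρ σ τ) {π : OK} (hπ : π ≠ 0) {m : OL}
    (hm : v = algebraMap OK OL π * m) (g : L ≃ₐ[K] L) :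
    ∃ ε : OLˣ, galRestrict OK K L OL g m = ε * m := by
  obtain ⟨ε, -, -, -, hε, -⟩ := h g
  have hπ0 : algebraMap OK OL π ≠ 0 :=
    (map_ne_zero_iff _ (FaithfulSMul.algebraMap_injective OK OL)).mpr hπ
  refine ⟨ε, mul_left_cancel₀ hπ0 ?_⟩
  rw [hm, map_mul, AlgEquiv.commutes] at hε
  rw [hε]
  ring

theorem exists_algebraMap_eq_of_isIntegralClosure (OK : Type*) {K OL L : Type*} [CommRing OK]
    [IsDomain OK] [IsIntegrallyClosed OK] [Field K] [Algebra OK K] [IsFractionRing OK K] [Field L]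
    [Algebra K L] [CommRing OL] [Algebra OK OL] [Algebra OL L] [Algebra OK L]
    [IsScalarTower OK K L] [IsScalarTower OK OL L] [IsIntegralClosure OL OK L] {x : K} {y : OL}
    (h : algebraMap OL L y = algebraMap K L x) : ∃ z : OK, algebraMap OK K z = x := by
  apply IsIntegrallyClosed.isIntegral_iff.mp
  have : IsIntegral OK (algebraMap K L x) := 
    h ▸ (IsIntegralClosure.isIntegral OK L y).algebraMap
  exact (isIntegral_algHom_iff (IsScalarTower.toAlgHom OK K L) (algebraMap K L).injective).mp this

variable [IsDiscreteValuationRing OK]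

/-- If `θ / π` does not lie in the codifferent, then some multiple of `θ` has trace one. -/
theorem exists_trace_mul_eq_one [Algebra.IsSeparable K L] [IsDedekindDomain OL]
    [Module.IsTorsionFree OK OL] [IsFractionRing OL L] {π : OK} (hπ : Irreducible π) (θ : L)
    (h : ¬ ∀ d ∈ differentIdeal OK OL, ∃ c : OL,
      algebraMap OL L c * algebraMap OK L π = algebraMap OL L d * θ) :
    ∃ b : OL, Algebra.trace K L (algebraMap OL L b * θ) = 1 := by
  -- The traces of the multiples of θ form an `OK`-submodule of `K`. If it does not contain 1, it
  -- lies in π`OK`, which says that θ/π belongs to the codifferent.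
  contrapose! h
  have hπK : algebraMap OK K π ≠ 0 :=
    (map_ne_zero_iff _ (IsFractionRing.injective OK K)).mpr hπ.ne_zero
  have hπL : algebraMap OK L π ≠ 0 := by
    rw [IsScalarTower.algebraMap_apply OK K L]
    exact (map_ne_zero_iff _ (algebraMap K L).injective).mpr hπK
  have key (b : OL) : ∃ c : OK, algebraMap OK K c * algebraMap OK K π =
      Algebra.trace K L (algebraMap OL L b * θ) := by
    by_cases h0 : Algebra.trace K L (algebraMap OL L b * θ) = 0
    · exact ⟨0, by rw [h0, map_zero, zero_mul]⟩
    rcases ValuationRing.isInteger_or_isInteger OK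
      (Algebra.trace K L (algebraMap OL L b * θ) / algebraMap OK K π) with ⟨c, hc⟩ | ⟨c, hc⟩
    · exact ⟨c, by rw [hc, div_mul_cancel₀ _ hπK]⟩
    · by_cases hu : IsUnit c
      · obtain ⟨u, rfl⟩ := hu
        refine ⟨(u⁻¹ : OKˣ), ?_⟩
        have hu1 : algebraMap OK K (u⁻¹ : OKˣ) * algebraMap OK K u = 1 := by
          rw [← map_mul, Units.inv_mul, map_one]
        rw [hc] at hu1
        field_simp at hu1
        exact hu1
      · have hc' : c ∈ IsLocalRing.maximalIdeal OK := hu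
        rw [hπ.maximalIdeal_eq, Ideal.mem_span_singleton] at hc'
        obtain ⟨c', rfl⟩ := hc'
        refine absurd ?_ (h (algebraMap OK OL c' * b))
        rw [map_mul (algebraMap OL L), ← IsScalarTower.algebraMap_apply,
          IsScalarTower.algebraMap_apply OK K L,
          mul_assoc, ← Algebra.smul_def, map_smul, smul_eq_mul]
        rw [map_mul] at hc
        field_simp at hc
        exact hc
  intro d hd
  have hmem : algebraMap OL L d ∈ IsLocalization.coeSubmodule L (differentIdeal OK OL) :=
    Submodule.mem_map_of_mem hd
  rw [coeSubmodule_differentIdeal OK K, Submodule.mem_div_iff_forall_mul_mem] at hmem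
  have hθ : θ * (algebraMap OK L π)⁻¹ ∈ Submodule.traceDual OK K (1 : Submodule OL L) := by
    rw [Submodule.mem_traceDual]
    intro x hx
    rw [Submodule.mem_one] at hx
    obtain ⟨b, rfl⟩ := hx
    obtain ⟨c, hc⟩ := key b
    refine ⟨c, mul_right_cancel₀ hπK ?_⟩
    rw [hc, Algebra.traceForm_apply, mul_comm _ (algebraMap OK K π),
      ← smul_eq_mul (algebraMap OK K π), ← map_smul, Algebra.smul_def (algebraMap OK K π), ← IsScalarTower.algebraMap_apply]
    congr 1
    field_simp
  obtain ⟨c, hc⟩ := Submodule.mem_one.mp (hmem _ hθ)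
  refine ⟨c, ?_⟩
  rw [hc]
  field_simp

/-- The norm of v is a product of conjugates, each a unit times v, so it is a unit times v^N with N
the order of the Galois group. It also lies in `OK`, where it is a unit times a power of π. -/
theorem IsGaloisCompatible.associated_pow [IsGalois K L] [IsDomain OL]
    [Module.IsTorsionFree OK OL] {v ρ σ τ : OL} (hv : v ≠ 0)
    (h : IsGaloisCompatible OK K OL L v ρ σ τ) {π : OK} (hπ : Irreducible π) :
    ∃ N j : ℕ, N ≠ 0 ∧ Associated (v ^ N) (algebraMap OK OL π ^ j) := by
  have hinj : Function.Injective (algebraMap OL L) := IsIntegralClosure.algebraMap_injective OL OK L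
  choose ε _ _ _ hε _ using h
  have hnorm := Algebra.norm_eq_prod_automorphisms K (algebraMap OL L v)
  simp_rw [← algebraMap_galRestrict_apply OK, hε, ← map_prod, Finset.prod_mul_distrib,
    Finset.prod_const, Finset.card_univ] at hnorm
  obtain ⟨n, hn⟩ := exists_algebraMap_eq_of_isIntegralClosure OK hnorm.symm
  rw [← hn, ← IsScalarTower.algebraMap_apply, IsScalarTower.algebraMap_apply OK OL L] at hnorm
  have hnorm := hinj hnorm
  have hn0 : n ≠ 0 := by
    rintro rfl
    rw [map_zero] at hnorm
    simp [hv, Finset.prod_eq_zero_iff] at hnorm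
  obtain ⟨j, u, rfl⟩ := IsDiscreteValuationRing.eq_unit_mul_pow_irreducible hn0 hπ
  refine ⟨Fintype.card (L ≃ₐ[K] L), j, Fintype.card_ne_zero, ?_⟩
  rw [map_mul, map_pow] at hnorm
  refine ⟨(∏ x, ε x) * (Units.map (algebraMap OK OL).toMonoidHom u)⁻¹, ?_⟩
  rw [Units.val_mul, ← mul_assoc, Units.mul_inv_eq_iff_eq_mul, Units.coe_prod]
  simpa [mul_comm] using hnorm.symm

theorem ordAt_algebraMap [IsDedekindDomain OL] [Module.IsTorsionFree OK OL] (p : Ideal OL)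
    [p.IsMaximal] [p.LiesOver (IsLocalRing.maximalIdeal OK)] {π : OK}
    (hπ : Irreducible π) : ordAt p (algebraMap OK OL π) = p.ramificationIdx OK := by
  have hne : (IsLocalRing.maximalIdeal OK).map (algebraMap OK OL) ≠ ⊥ :=
    Ideal.map_ne_bot_of_ne_bot (IsDiscreteValuationRing.not_a_field OK)
  rw [Ideal.IsDedekindDomain.ramificationIdx_eq_multiplicity (IsLocalRing.maximalIdeal OK) p hne,
    hπ.maximalIdeal_eq, Ideal.map_span, Set.image_singleton, ordAt]

/-- The comparison of the orders of `π` and of `v` at one prime decides divisibility. -/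
theorem IsGaloisCompatible.dvd_of_ordAt_le [IsGalois K L] [IsDedekindDomain OL]
    [Module.IsTorsionFree OK OL] {v ρ σ τ : OL} (hv : v ≠ 0)
    (h : IsGaloisCompatible OK K OL L v ρ σ τ) {π : OK} (hπ : Irreducible π) {p : Ideal OL}
    [p.IsPrime] (hp0 : p ≠ ⊥) (he : 0 < ordAt p (algebraMap OK OL π)) (a b : ℕ) :
    (a * ordAt p (algebraMap OK OL π) ≤ b * ordAt p v → algebraMap OK OL π ^ a ∣ v ^ b) ∧
    (b * ordAt p v ≤ a * ordAt p (algebraMap OK OL π) → v ^ b ∣ algebraMap OK OL π ^ a) := by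
  obtain ⟨N, j, hN, hassoc⟩ := h.associated_pow hv hπ
  have hπ0 : algebraMap OK OL π ≠ 0 :=
    (map_ne_zero_iff _ (FaithfulSMul.algebraMap_injective OK OL)).mpr hπ.ne_zero
  have hord : N * ordAt p v = j * ordAt p (algebraMap OK OL π) := by
    rw [← ordAt_pow hp0 hv, ← ordAt_pow hp0 hπ0]
    exact le_antisymm (ordAt_le_of_dvd hp0 (pow_ne_zero _ hπ0) hassoc.dvd)
      (ordAt_le_of_dvd hp0 (pow_ne_zero _ hv) hassoc.symm.dvd)
  have hvb : Associated ((v ^ b) ^ N) (algebraMap OK OL π ^ (j * b)) := by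
    rw [← pow_mul, mul_comm b N, pow_mul, pow_mul]
    exact hassoc.pow_pow
  constructor
  · intro hab
    have : a * N ≤ j * b := by
      refine Nat.le_of_mul_le_mul_right ?_ he
      calc a * N * ordAt p (algebraMap OK OL π)
          = N * (a * ordAt p (algebraMap OK OL π)) := by ring
        _ ≤ N * (b * ordAt p v) := Nat.mul_le_mul_left _ hab
        _ = b * (N * ordAt p v) := by ring
        _ = j * b * ordAt p (algebraMap OK OL π) := by rw [hord]; ring
    -- Divisibility may be tested on N-th powers, and the N-th power of v^b is a power of π up to a
    -- unit.
    rw [← IsIntegrallyClosed.pow_dvd_pow_iff hN, ← pow_mul]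
    exact (pow_dvd_pow _ this).trans hvb.symm.dvd
  · intro hab
    have : j * b ≤ a * N := by
      refine Nat.le_of_mul_le_mul_right ?_ he
      calc j * b * ordAt p (algebraMap OK OL π)
          = b * (j * ordAt p (algebraMap OK OL π)) := by ring
        _ = N * (b * ordAt p v) := by rw [← hord]; ring
        _ ≤ N * (a * ordAt p (algebraMap OK OL π)) := Nat.mul_le_mul_left _ hab
        _ = a * N * ordAt p (algebraMap OK OL π) := by ring
    rw [← IsIntegrallyClosed.pow_dvd_pow_iff hN, ← pow_mul _ a]
    exact hvb.dvd.trans (pow_dvd_pow _ this)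

end Galois

/-! ### Descent of the intermediate curve to `OK`, and approximation over `K`. -/

section Descent

variable {OK K OL L : Type*} [CommRing OK] [Field K] [Algebra OK K]
  [Field L] [Algebra K L]
  [CommRing OL] [Algebra OK OL] [Algebra OL L] [Algebra OK L]
  [IsScalarTower OK K L] [IsScalarTower OK OL L]

/-- `v, ρ, σ, τ` are the coefficients of the change of coordinates from a model over `OK` to a
model over `OL`. -/
def WeierstrassModel.IsTransition {E : WeierstrassCurve K} (W : WeierstrassModel OK E)
    (W' : WeierstrassModel OL (E.map (algebraMap K L))) (v ρ σ τ : OL) : Prop :=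
  algebraMap OL L v = ((W.baseChange OL L).transition W').u ∧
    algebraMap OL L ρ = ((W.baseChange OL L).transition W').r ∧
    algebraMap OL L σ = ((W.baseChange OL L).transition W').s ∧
    algebraMap OL L τ = ((W.baseChange OL L).transition W').t

theorem WeierstrassModel.IsTransition.ne_zero {E : WeierstrassCurve K} {W : WeierstrassModel OK E}
    {W' : WeierstrassModel OL (E.map (algebraMap K L))} {v ρ σ τ : OL}
    (hD : W.IsTransition W' v ρ σ τ) : v ≠ 0 := by
  rintro rfl
  exact Units.ne_zero _ (hD.1.symm.trans (map_zero _))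

/-- The change of coordinates `(X, Y) ↦ (π²X + r, π³Y + π²sX + t)` over `K` approximates the one
with translation part `ρ, σ, τ`: the latter factors through it with an integral translation
part. -/
def Approximates (π : OK) (ρ σ τ : OL) (r s t : K) : Prop :=
  ∃ h₁ h₂ h₃ : OL,
    algebraMap OL L ρ = algebraMap OK L π ^ 2 * algebraMap OL L h₁ + algebraMap K L r ∧
    algebraMap OL L σ = algebraMap OK L π * algebraMap OL L h₂ + algebraMap K L s ∧
    algebraMap OL L τ = algebraMap OK L π ^ 3 * algebraMap OL L h₃ +
      algebraMap OK L π ^ 2 * algebraMap OL L h₁ * algebraMap K L s + algebraMap K L t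

/-- An approximation splits the transition into a substitution `C` over `K` with scaling factor π
and an integral substitution `H`. The curve in between is integral over `OL` by `descend` and
defined over `K`, hence a model over `OK` whose discriminant is smaller by π¹². -/
theorem WeierstrassModel.IsMinimal.not_approximates [IsDomain OK] [IsIntegrallyClosed OK]
    [IsFractionRing OK K] [IsIntegralClosure OL OK L] {E : WeierstrassCurve K} [E.IsElliptic]
    {W : WeierstrassModel OK E} (hW : W.IsMinimal)
    {W' : WeierstrassModel OL (E.map (algebraMap K L))} {v ρ σ τ : OL}
    (hD : W.IsTransition W' v ρ σ τ) {π : OK} (hπ : Irreducible π)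
    (hdvd : algebraMap OK OL π ∣ v) (r s t : K) :
    ¬ Approximates (L := L) π ρ σ τ r s t := by
  rintro ⟨h₁, h₂, h₃, e1, e2, e3⟩
  obtain ⟨hDu, hDr, hDs, hDt⟩ := hD
  obtain ⟨m, rfl⟩ := hdvd
  have hπK : algebraMap OK K π ≠ 0 :=
    (map_ne_zero_iff _ (IsFractionRing.injective OK K)).mpr hπ.ne_zero
  have hvm : algebraMap OL L m ≠ 0 := by
    intro h
    rw [map_mul, h, mul_zero] at hDu
    exact Units.ne_zero _ hDu.symm
  let C : WeierstrassCurve.VariableChange K := ⟨Units.mk0 _ hπK, r, s, t⟩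
  let H : WeierstrassCurve.VariableChange L :=
    ⟨Units.mk0 _ hvm, algebraMap OL L h₁, algebraMap OL L h₂, algebraMap OL L h₃⟩
  have hπL : algebraMap K L (algebraMap OK K π) = algebraMap OK L π :=
    (IsScalarTower.algebraMap_apply OK K L π).symm
  have hfac : (W.baseChange OL L).transition W' = H * C.map (algebraMap K L) := by
    ext
    · rw [← hDu, map_mul, ← IsScalarTower.algebraMap_apply, ← hπL]
      simp [H, C, WeierstrassCurve.VariableChange.mul_def, mul_comm]
    · rw [← hDr, e1, ← hπL]
      simp [H, C, WeierstrassCurve.VariableChange.mul_def, mul_comm]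
    · rw [← hDs, e2, ← hπL]
      simp [H, C, WeierstrassCurve.VariableChange.mul_def]
    · rw [← hDt, e3, ← hπL]
      simp [H, C, WeierstrassCurve.VariableChange.mul_def]
      ring
  have hL : (C • W.eqn.map (algebraMap OK K)).map (algebraMap K L) =
      (W'.eqn.descend m h₁ h₂ h₃).map (algebraMap OL L) := by
    have h1 := (W.baseChange OL L).transition_smul W'
    have h2 := WeierstrassCurve.variableChange_smul_descend W'.eqn m h₁ h₂ h₃ H rfl rfl rfl rfl
    rw [← h2, hfac, mul_smul, smul_left_cancel_iff] at h1
    rw [← h1, ← WeierstrassCurve.map_variableChange]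
    congr 1
    simp only [WeierstrassModel.baseChange, WeierstrassCurve.map_map,
      ← IsScalarTower.algebraMap_eq]
  obtain ⟨a₁, h1⟩ := exists_algebraMap_eq_of_isIntegralClosure OK
    (congrArg WeierstrassCurve.a₁ hL).symm
  obtain ⟨a₂, h2⟩ := exists_algebraMap_eq_of_isIntegralClosure OK
    (congrArg WeierstrassCurve.a₂ hL).symm
  obtain ⟨a₃, h3⟩ := exists_algebraMap_eq_of_isIntegralClosure OK
    (congrArg WeierstrassCurve.a₃ hL).symm
  obtain ⟨a₄, h4⟩ := exists_algebraMap_eq_of_isIntegralClosure OK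
    (congrArg WeierstrassCurve.a₄ hL).symm
  obtain ⟨a₆, h6⟩ := exists_algebraMap_eq_of_isIntegralClosure OK
    (congrArg WeierstrassCurve.a₆ hL).symm
  let Z : WeierstrassModel OK E :=
    { eqn := ⟨a₁, a₂, a₃, a₄, a₆⟩
      change := C * W.change
      change_smul := by
        rw [mul_smul, W.change_smul]
        ext
        exacts [h1.symm, h2.symm, h3.symm, h4.symm, h6.symm] }
  have hZ : W.transition Z = C := by simp [WeierstrassModel.transition, Z]
  have hΔ := W.algebraMap_Δ_transition Z
  rw [hZ] at hΔ
  replace hΔ : W.eqn.Δ = π ^ 12 * Z.eqn.Δ := by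
    apply IsFractionRing.injective OK K
    rw [hΔ, map_mul, map_pow]
    rfl
  obtain ⟨c, hc⟩ := Ideal.mem_span_singleton'.mp (hW Z (Ideal.mem_span_singleton_self _))
  rw [← hc, ← mul_assoc] at hΔ
  have h1 : π ^ 12 * c = 1 := mul_right_cancel₀ W.Δ_ne_zero (by rw [← hΔ, one_mul])
  exact hπ.not_isUnit (IsUnit.of_mul_eq_one (π ^ 11 * c) (by rw [← h1]; ring))

variable [FiniteDimensional K L] [IsGalois K L] [IsDomain OK]
  [IsFractionRing OK K] [IsIntegralClosure OL OK L] [IsDomain OL] [Module.IsTorsionFree OK OL]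

/-- The conjugates of ρ and σ differ from them by multiples of v² and v. Averaging divides these
errors by m, leaving multiples of v²/m = π²m and v/m = π. -/
theorem IsGaloisCompatible.exists_approximates {v ρ σ τ m b : OL}
    (h : IsGaloisCompatible OK K OL L v ρ σ τ) {π : OK} (hπ : π ≠ 0)
    (hm : v = algebraMap OK OL π * m) (hm0 : algebraMap OL L m ≠ 0)
    (hb : Algebra.trace K L (algebraMap OL L b * (algebraMap OL L m)⁻¹) = 1) :
    ∃ r s t : K, Approximates (L := L) π ρ σ τ r s t := by
  obtain ⟨c, hc⟩ := exists_average (OK := OK) hm0 (h.exists_unit_of_eq_mul hπ hm) hb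
  choose ε r s t hv hr hs ht using h
  obtain ⟨r', er⟩ := hc ρ _ hr
  obtain ⟨s', es⟩ := hc σ _ hs
  -- Averaging τ itself would meet the error rσv², which has only two factors v and a varying
  -- coefficient r. In σρ - τ, a translation term of the inverse substitution, it cancels; the
  -- remaining term vsρ averages to ρ times the error already found for σ.
  obtain ⟨κ, eκ⟩ := hc (σ * ρ - τ) (fun g ↦ v * s g * (r g * v ^ 2) + v * s g * ρ - t g * v ^ 3)
    (fun g ↦ by rw [map_sub, map_mul, hs, hr, ht]; ring)
  have hA : ∑ g, c g * (r g * v ^ 2) = v ^ 2 * ∑ g, c g * r g := by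
    rw [Finset.mul_sum]; exact Finset.sum_congr rfl fun g _ ↦ by ring
  have hB : ∑ g, c g * (v * s g) = v * ∑ g, c g * s g := by
    rw [Finset.mul_sum]; exact Finset.sum_congr rfl fun g _ ↦ by ring
  have hT : ∑ g, c g * (v * s g * (r g * v ^ 2) + v * s g * ρ - t g * v ^ 3) =
      v ^ 3 * ∑ g, c g * (s g * r g - t g) + v * ρ * ∑ g, c g * s g := by
    rw [Finset.mul_sum, Finset.mul_sum, ← Finset.sum_add_distrib]
    exact Finset.sum_congr rfl fun g _ ↦ by ring
  rw [hA, hm] at er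
  rw [hB, hm] at es
  rw [hT, hm] at eκ
  generalize ∑ g, c g * r g = A at *
  generalize ∑ g, c g * s g = B at *
  generalize ∑ g, c g * (s g * r g - t g) = T at *
  simp only [map_add, map_mul, map_pow, map_sub, ← IsScalarTower.algebraMap_apply OK OL L]
    at er es eκ
  have er' : algebraMap K L r' = algebraMap OL L ρ +
      algebraMap OK L π ^ 2 * algebraMap OL L m * algebraMap OL L A :=
    mul_left_cancel₀ hm0 (by rw [er]; ring)
  have es' : algebraMap K L s' = algebraMap OL L σ + algebraMap OK L π * algebraMap OL L B :=
    mul_left_cancel₀ hm0 (by rw [es]; ring)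
  have eκ' : algebraMap K L κ = algebraMap OL L σ * algebraMap OL L ρ - algebraMap OL L τ +
      algebraMap OK L π ^ 3 * algebraMap OL L m ^ 2 * algebraMap OL L T +
      algebraMap OK L π * algebraMap OL L ρ * algebraMap OL L B :=
    mul_left_cancel₀ hm0 (by rw [eκ]; ring)
  refine ⟨r', s', s' * r' - κ, -(m * A), -B, m ^ 2 * T, ?_, ?_, ?_⟩ <;>
    simp only [map_neg, map_mul, map_pow, map_sub, er', es', eκ'] <;> ring

/-- Since the conjugates of ρ differ from it by multiples of v² = π²m², the denominator m² may be
used in place of m, which makes the trace condition easier to satisfy. -/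
theorem IsGaloisCompatible.exists_sub_mem {v ρ σ τ m b : OL}
    (h : IsGaloisCompatible OK K OL L v ρ σ τ) {π : OK} (hπ : π ≠ 0)
    (hm : v = algebraMap OK OL π * m) (hm0 : algebraMap OL L m ≠ 0)
    (hb : Algebra.trace K L (algebraMap OL L b * (algebraMap OL L (m ^ 2))⁻¹) = 1) :
    ∃ (r : K) (h₁ : OL),
      algebraMap OL L ρ = algebraMap OK L π ^ 2 * algebraMap OL L h₁ + algebraMap K L r := by
  have hm2 : algebraMap OL L (m ^ 2) ≠ 0 := by rw [map_pow]; exact pow_ne_zero _ hm0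
  obtain ⟨c, hc⟩ := exists_average (OK := OK) hm2 (fun g ↦ by
    obtain ⟨ε, hε⟩ := h.exists_unit_of_eq_mul hπ hm g
    exact ⟨ε ^ 2, by rw [map_pow, hε, Units.val_pow_eq_pow_val, mul_pow]⟩) hb
  choose ε r s t hv hr hs ht using h
  obtain ⟨r', er⟩ := hc ρ _ hr
  have hA : ∑ g, c g * (r g * v ^ 2) = v ^ 2 * ∑ g, c g * r g := by
    rw [Finset.mul_sum]; exact Finset.sum_congr rfl fun g _ ↦ by ring
  rw [hA, hm] at er
  refine ⟨r', -∑ g, c g * r g, mul_left_cancel₀ hm2 ?_⟩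
  rw [mul_add, er, map_neg]
  simp only [map_add, map_mul, map_pow, ← IsScalarTower.algebraMap_apply OK OL L]
  ring

end Descent

/-! ### Trace one from orders at p, and denominators of coefficients. -/

section Bound

variable {OK K OL L : Type*} [CommRing OK] [IsDomain OK] [IsDiscreteValuationRing OK] [Field K]
  [Algebra OK K] [IsFractionRing OK K] [Field L] [Algebra K L] [FiniteDimensional K L]
  [IsGalois K L] [CommRing OL] [Algebra OK OL] [Algebra OL L] [Algebra OK L]
  [IsScalarTower OK K L] [IsScalarTower OK OL L] [IsIntegralClosure OL OK L]
  [IsDedekindDomain OL] [Module.IsTorsionFree OK OL]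

/-- If the order of `m π` at `p` exceeds the exponent of the different together with the order of
some `c`, then `c / m` has a multiple of trace one. -/
theorem exists_trace_mul_inv_eq_one (p : Ideal OL) [p.IsPrime] (hp0 : p ≠ ⊥) {π : OK}
    (hπ : Irreducible π) {m c : OL} (hm : m ≠ 0) (hc : c ≠ 0)
    (h : differentExponent OK p + ordAt p c < ordAt p (m * algebraMap OK OL π)) :
    ∃ b : OL, Algebra.trace K L
      (algebraMap OL L b * (algebraMap OL L c * (algebraMap OL L m)⁻¹)) = 1 := by
  have := IsIntegralClosure.isFractionRing_of_finite_extension OK K L OL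
  have hinj := IsFractionRing.injective OL L
  have hm0 : algebraMap OL L m ≠ 0 := (map_ne_zero_iff _ hinj).mpr hm
  have : Module.Finite OK OL := IsIntegralClosure.finite OK K L OL
  have hD : differentIdeal OK OL ≠ ⊥ := by
    rw [ne_eq, ← FractionalIdeal.coeIdeal_inj (K := L), coeIdeal_differentIdeal (K := K)]
    simp
  -- If c/(mπ) were in the codifferent, mπ would divide c times every element of the different,
  -- against the orders at p.
  refine exists_trace_mul_eq_one hπ _ fun hall ↦ h.not_ge ?_
  refine ordAt_le_multiplicity_add hp0 hD hc fun d hd ↦ ?_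
  obtain ⟨k, hk⟩ := hall d hd
  refine ⟨k, hinj ?_⟩
  rw [IsScalarTower.algebraMap_apply OK OL L] at hk
  simp only [map_mul]
  field_simp at hk
  linear_combination -hk

end Bound

theorem liesOver_maximalIdeal_of_isIntegral {OK OL : Type*} [CommRing OK] [IsLocalRing OK]
    [CommRing OL] [Algebra OK OL] [Algebra.IsIntegral OK OL] (p : Ideal OL) [p.IsMaximal] :
    p.LiesOver (IsLocalRing.maximalIdeal OK) :=
  ⟨(IsLocalRing.eq_maximalIdeal
    (Ideal.isMaximal_comap_of_isIntegral_of_isMaximal (R := OK) p)).symm⟩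

/-- In a valuation ring, an element of the fraction field that is not integral has its inverse in
the maximal ideal; this accounts for the exponent M + 1. -/
theorem exists_pow_mul_eq_or {OK K : Type*} [CommRing OK] [IsDomain OK]
    [IsDiscreteValuationRing OK] [Field K] [Algebra OK K] [IsFractionRing OK K] {π : OK}
    (hπ : Irreducible π) (γ : K) (M : ℕ) :
    (∃ z : OK, algebraMap OK K z = algebraMap OK K π ^ M * γ) ∨
      ∃ c : OK, γ * (algebraMap OK K π ^ (M + 1) * algebraMap OK K c) = 1 := by
  have hπK : algebraMap OK K π ≠ 0 :=
    (map_ne_zero_iff _ (IsFractionRing.injective OK K)).mpr hπ.ne_zero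
  by_cases hγ : γ = 0
  · exact .inl ⟨0, by rw [hγ, map_zero, mul_zero]⟩
  rcases ValuationRing.isInteger_or_isInteger OK (algebraMap OK K π ^ M * γ) with
    ⟨c, hc⟩ | ⟨c, hc⟩
  · exact .inl ⟨c, hc⟩
  by_cases hu : IsUnit c
  · obtain ⟨u, rfl⟩ := hu
    refine .inl ⟨(u⁻¹ : OKˣ), ?_⟩
    have hu1 : algebraMap OK K (u⁻¹ : OKˣ) * algebraMap OK K u = 1 := by
      rw [← map_mul, Units.inv_mul, map_one]
    rw [eq_inv_of_mul_eq_one_left hu1, hc, inv_inv]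
  · have hc' : c ∈ IsLocalRing.maximalIdeal OK := hu
    rw [hπ.maximalIdeal_eq, Ideal.mem_span_singleton] at hc'
    obtain ⟨c, rfl⟩ := hc'
    refine .inr ⟨c, ?_⟩
    rw [map_mul] at hc
    field_simp at hc
    linear_combination hc

/-- If `γ vⁱ` is integral and `vⁱ` is not divisible by `π ^ (M + 1)`, then `π ^ M γ` is
integral. -/
theorem exists_pow_mul_eq_of_not_dvd {OK K OL L : Type*} [CommRing OK] [IsDomain OK]
    [IsDiscreteValuationRing OK] [Field K] [Algebra OK K] [IsFractionRing OK K] [Field L]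
    [Algebra K L] [CommRing OL] [Algebra OK OL] [Algebra OL L] [Algebra OK L]
    [IsScalarTower OK K L] [IsScalarTower OK OL L] [FaithfulSMul OL L] {π : OK}
    (hπ : Irreducible π) {γ : K} {v k : OL} {i M : ℕ}
    (hk : algebraMap OL L k = algebraMap K L γ * algebraMap OL L v ^ i)
    (hM : ¬ algebraMap OK OL π ^ (M + 1) ∣ v ^ i) :
    ∃ z : OK, algebraMap OK K z = algebraMap OK K π ^ M * γ := by
  refine (exists_pow_mul_eq_or hπ γ M).resolve_right ?_
  rintro ⟨c, hγc⟩
  have hγL := congrArg (algebraMap K L) hγc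
  simp only [map_mul, map_pow, map_one, ← IsScalarTower.algebraMap_apply OK K L] at hγL
  refine hM ⟨algebraMap OK OL c * k, FaithfulSMul.algebraMap_injective OL L ?_⟩
  simp only [map_mul, map_pow, ← IsScalarTower.algebraMap_apply OK OL L, hk]
  linear_combination -(algebraMap OL L v ^ i) * hγL

section Leading

variable {OK K OL L : Type*} [CommRing OK] [IsDomain OK] [IsIntegrallyClosed OK] [Field K]
  [Algebra OK K] [IsFractionRing OK K] [Field L] [Algebra K L] [CommRing OL] [Algebra OK OL]
  [Algebra OL L] [Algebra OK L] [IsScalarTower OK K L] [IsScalarTower OK OL L]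
  [IsIntegralClosure OL OK L]

/-- If the leading coefficient of an invariant function becomes integral after multiplication by a
power of `π` divisible by `v²`, then so do its other coefficients. -/
theorem exists_pow_mul_eq_of_leading {v ρ σ τ : OL} {π : OK} {M : ℕ}
    (hM : v ^ 2 ∣ algebraMap OK OL π ^ M) {γ α β : K} {k₁ k₂ : OL}
    (h₂ : algebraMap OL L k₂ =
      (algebraMap K L γ * algebraMap OL L σ + algebraMap K L α) * algebraMap OL L v ^ 2)
    (h₁ : algebraMap OL L k₁ = algebraMap K L γ * algebraMap OL L τ +
      algebraMap K L α * algebraMap OL L ρ + algebraMap K L β) {z : OK}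
    (hz : algebraMap OK K z = algebraMap OK K π ^ M * γ) :
    (∃ z : OK, algebraMap OK K z = algebraMap OK K π ^ M * α) ∧
      ∃ z : OK, algebraMap OK K z = algebraMap OK K π ^ M * β := by
  obtain ⟨w, hw⟩ := hM
  have hwL := congrArg (algebraMap OL L) hw
  have hzL := congrArg (algebraMap K L) hz
  simp only [map_mul, map_pow, ← IsScalarTower.algebraMap_apply OK OL L,
    ← IsScalarTower.algebraMap_apply OK K L] at hwL hzL
  have ha : algebraMap OL L (w * k₂ - algebraMap OK OL z * σ) =
      algebraMap K L (algebraMap OK K π ^ M * α) := by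
    simp only [map_sub, map_mul, map_pow, ← IsScalarTower.algebraMap_apply OK OL L,
      ← IsScalarTower.algebraMap_apply OK K L, h₂, hzL, hwL]
    ring
  have hb : algebraMap OL L (algebraMap OK OL π ^ M * k₁ - algebraMap OK OL z * τ -
      (w * k₂ - algebraMap OK OL z * σ) * ρ) = algebraMap K L (algebraMap OK K π ^ M * β) := by
    rw [map_sub, map_mul _ _ ρ, ha]
    simp only [map_sub, map_mul, map_pow, ← IsScalarTower.algebraMap_apply OK OL L,
      ← IsScalarTower.algebraMap_apply OK K L, h₁, hzL]
    ring
  exact ⟨exists_algebraMap_eq_of_isIntegralClosure OK ha,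
    exists_algebraMap_eq_of_isIntegralClosure OK hb⟩

end Leading

/-! ### The bound on v and the bound on the leading coefficient γ. -/

section Bound

variable {OK K OL L : Type*} [CommRing OK] [IsDomain OK] [IsDiscreteValuationRing OK] [Field K]
  [Algebra OK K] [IsFractionRing OK K] [Field L] [Algebra K L] [FiniteDimensional K L]
  [IsGalois K L] [CommRing OL] [Algebra OK OL] [Algebra OL L] [Algebra OK L]
  [IsScalarTower OK K L] [IsScalarTower OK OL L] [IsIntegralClosure OL OK L]
  [IsDedekindDomain OL] [Module.IsTorsionFree OK OL]

theorem ne_bot_of_liesOver_maximalIdeal (p : Ideal OL)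
    [hp : p.LiesOver (IsLocalRing.maximalIdeal OK)] : p ≠ ⊥ := by
  rintro rfl
  apply IsDiscreteValuationRing.not_a_field OK
  rw [hp.over]
  exact Ideal.comap_bot_of_injective _ (FaithfulSMul.algebraMap_injective OK OL)

section

variable {E : WeierstrassCurve K} [E.IsElliptic] {W : WeierstrassModel OK E}
  {W' : WeierstrassModel OL (E.map (algebraMap K L))} {v ρ σ τ : OL} {π : OK} {p : Ideal OL}

/-- The bound on the scaling factor of the change of coordinates between minimal models. -/
theorem WeierstrassModel.IsMinimal.ordAt_transition_lt (hW : W.IsMinimal)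
    (hD : W.IsTransition W' v ρ σ τ) (hG : IsGaloisCompatible OK K OL L v ρ σ τ)
    (hπ : Irreducible π) [p.IsPrime] (hp0 : p ≠ ⊥) (he : 0 < ordAt p (algebraMap OK OL π)) :
    ordAt p v < differentExponent OK p + ordAt p (algebraMap OK OL π) := by
  by_contra! hn
  have hv0 := hD.ne_zero
  have hdvd : algebraMap OK OL π ∣ v := by
    simpa using (hG.dvd_of_ordAt_le hv0 hπ hp0 he 1 1).1 (by omega)
  obtain ⟨m, hm⟩ := hdvd
  have hm0 : m ≠ 0 := by rintro rfl; exact hv0 (by rw [hm, mul_zero])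
  have hinj := IsIntegralClosure.algebraMap_injective OL OK L
  -- Since mπ = v, the order condition is that the order of v exceeds the exponent of the different.
  obtain ⟨b, hb⟩ := exists_trace_mul_inv_eq_one (K := K) (L := L) p hp0 hπ hm0 one_ne_zero (by
    rw [ordAt_of_isUnit isUnit_one, mul_comm, ← hm]; omega)
  rw [map_one, one_mul] at hb
  obtain ⟨r, s, t, h⟩ :=
    hG.exists_approximates hπ.ne_zero hm ((map_ne_zero_iff _ hinj).mpr hm0) hb
  exact hW.not_approximates hD hπ ⟨m, hm⟩ r s t h

/-- The bound on the leading coefficients of the invariants of `L(3ε')`. -/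
theorem WeierstrassModel.IsMinimal.exists_pow_mul_eq (hW : W.IsMinimal)
    (hD : W.IsTransition W' v ρ σ τ) (hG : IsGaloisCompatible OK K OL L v ρ σ τ)
    (hπ : Irreducible π) [p.IsPrime] (hp0 : p ≠ ⊥) (he : 0 < ordAt p (algebraMap OK OL π))
    {γ α β : K} {k₁ k₂ k₃ : OL}
    (h₃ : algebraMap OL L k₃ = algebraMap K L γ * algebraMap OL L v ^ 3)
    (h₂ : algebraMap OL L k₂ =
      (algebraMap K L γ * algebraMap OL L σ + algebraMap K L α) * algebraMap OL L v ^ 2)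
    (h₁ : algebraMap OL L k₁ = algebraMap K L γ * algebraMap OL L τ +
      algebraMap K L α * algebraMap OL L ρ + algebraMap K L β) {q : ℕ}
    (hq : differentExponent OK p < (q + 1) * ordAt p (algebraMap OK OL π)) :
    ∃ z : OK, algebraMap OK K z = algebraMap OK K π ^ (2 * q + 4) * γ := by
  have hn := hW.ordAt_transition_lt hD hG hπ hp0 he
  have hinj := IsIntegralClosure.algebraMap_injective OL OK L
  have hπ0 : algebraMap OK OL π ≠ 0 :=
    (map_ne_zero_iff _ (FaithfulSMul.algebraMap_injective OK OL)).mpr hπ.ne_zero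
  have hv0 := hD.ne_zero
  refine (exists_pow_mul_eq_or hπ γ (2 * q + 4)).resolve_right ?_
  rintro ⟨c, hγc⟩
  have hγL : algebraMap K L γ * (algebraMap OK L π ^ (2 * q + 5) * algebraMap OK L c) = 1 := by
    have := congrArg (algebraMap K L) hγc
    simpa only [map_mul, map_pow, map_one, ← IsScalarTower.algebraMap_apply OK K L] using this
  have hγL0 : algebraMap K L γ ≠ 0 := left_ne_zero_of_mul_eq_one hγL
  -- With 1/γ = π^(2q+5)c, the integrality of γv³ forces 3n ≥ (2q+5)e. This lower bound for n drives
  -- the rest of the argument.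
  have hdvd3 : algebraMap OK OL π ^ (2 * q + 5) ∣ v ^ 3 := by
    refine ⟨algebraMap OK OL c * k₃, hinj ?_⟩
    simp only [map_mul, map_pow, ← IsScalarTower.algebraMap_apply OK OL L, h₃]
    linear_combination -(algebraMap OL L v ^ 3) * hγL
  have hord := ordAt_le_of_dvd hp0 (pow_ne_zero _ hv0) hdvd3
  rw [ordAt_pow hp0 hv0, ordAt_pow hp0 hπ0] at hord
  set e := ordAt p (algebraMap OK OL π) with hedef
  set n := ordAt p v with hndef
  set d := differentExponent OK p with hddef
  have hdvd : algebraMap OK OL π ∣ v := by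
    simpa using (hG.dvd_of_ordAt_le hv0 hπ hp0 he 1 1).1 (by rw [← hedef, ← hndef]; nlinarith)
  -- From n < d + e and d < (q+1)e one gets n < (q+2)e.
  obtain ⟨w, hw⟩ := (hG.dvd_of_ordAt_le hv0 hπ hp0 he (2 * q + 4) 2).2
    (by rw [← hedef, ← hndef]; nlinarith)
  obtain ⟨m, hm⟩ := id hdvd
  have hm0 : m ≠ 0 := by rintro rfl; exact hv0 (by rw [hm, mul_zero])
  have hmord : n = e + ordAt p m := by rw [hndef, hm, ordAt_mul hp0 hπ0 hm0]
  -- The order of m²π is 2n - e ≥ (4q+7)e/3 ≥ (q+1)e > d.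
  obtain ⟨b, hb⟩ := exists_trace_mul_inv_eq_one (K := K) (L := L) p hp0 hπ
    (pow_ne_zero 2 hm0) one_ne_zero (by
    rw [ordAt_of_isUnit isUnit_one, ordAt_mul hp0 (pow_ne_zero 2 hm0) hπ0, ordAt_pow hp0 hm0,
      ← hedef, ← hddef]
    nlinarith)
  rw [map_one, one_mul] at hb
  obtain ⟨r, g₁, hr⟩ :=
    hG.exists_sub_mem hπ.ne_zero hm ((map_ne_zero_iff _ hinj).mpr hm0) hb
  -- The invariant function divided by γ is y + (α/γ)x + β/γ, so s = -α/γ gives σ - s = k₂/(γv²),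
  -- which is divisible by π because v² divides π^(2q+4). With this t, the error in τ is k₁/γ, a
  -- multiple of π^(2q+5) and so of π³.
  refine hW.not_approximates hD hπ hdvd r (-α / γ) (-α / γ * r - β / γ)
    ⟨g₁, w * algebraMap OK OL c * k₂, algebraMap OK OL π ^ (2 * q + 2) * algebraMap OK OL c * k₁,
      hr, ?_, ?_⟩
  · have hwL := congrArg (algebraMap OL L) hw
    simp only [map_mul, map_pow, ← IsScalarTower.algebraMap_apply OK OL L] at hwL
    simp only [map_mul, map_div₀, map_neg, ← IsScalarTower.algebraMap_apply OK OL L, h₂]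
    have e1 : algebraMap OK L π * (algebraMap OL L w * algebraMap OK L c *
        ((algebraMap K L γ * algebraMap OL L σ + algebraMap K L α) * algebraMap OL L v ^ 2)) =
        (algebraMap K L γ * algebraMap OL L σ + algebraMap K L α) * (algebraMap K L γ)⁻¹ := by
      rw [← eq_inv_of_mul_eq_one_right hγL]
      linear_combination -(algebraMap OK L π * algebraMap OK L c *
        (algebraMap K L γ * algebraMap OL L σ + algebraMap K L α)) * hwL
    rw [e1]
    field_simp
    ring
  · rw [← sub_eq_iff_eq_add.mpr hr]
    simp only [map_mul, map_sub, map_pow, map_div₀, map_neg,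
      ← IsScalarTower.algebraMap_apply OK OL L, h₁]
    have e1 : algebraMap OK L π ^ 3 * (algebraMap OK L π ^ (2 * q + 2) * algebraMap OK L c *
        (algebraMap K L γ * algebraMap OL L τ + algebraMap K L α * algebraMap OL L ρ +
          algebraMap K L β)) = (algebraMap K L γ * algebraMap OL L τ +
          algebraMap K L α * algebraMap OL L ρ + algebraMap K L β) * (algebraMap K L γ)⁻¹ := by
      rw [← eq_inv_of_mul_eq_one_right hγL]
      ring
    rw [e1]
    field_simp
    ring

end

end Bound

/-! ### Coordinate functions of a model and Weierstrass bases. -/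

open WeierstrassCurve.Affine

namespace WeierstrassModel

section Coordinates

variable {R K : Type*} [CommRing R] [Field K] [Algebra R K] {E : WeierstrassCurve K}

theorem smul_one_eq_mk (a : K) : a • (1 : E.toAffine.CoordinateRing) =
    CoordinateRing.mk E.toAffine (C (C a)) := by
  rw [Algebra.smul_def, mul_one]; rfl

theorem smul_eq_mk_mul (a : K) (f : E.toAffine.CoordinateRing) : a • f =
    CoordinateRing.mk E.toAffine (C (C a)) * f := by
  rw [Algebra.smul_def]; rfl

theorem x_eq (W : WeierstrassModel R E) :
    W.x = ((W.change.u⁻¹ : Kˣ) ^ 2 : K) •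
      (CoordinateRing.mk E.toAffine (C X) - W.change.r • (1 : E.toAffine.CoordinateRing)) := by
  rw [smul_one_eq_mk, smul_eq_mk_mul, x]
  simp only [map_mul, map_sub]

theorem y_eq (W : WeierstrassModel R E) :
    W.y = ((W.change.u⁻¹ : Kˣ) ^ 3 : K) •
      (CoordinateRing.mk E.toAffine X - W.change.s • (CoordinateRing.mk E.toAffine (C X)
        - W.change.r • (1 : E.toAffine.CoordinateRing))
        - W.change.t • (1 : E.toAffine.CoordinateRing)) := by
  simp only [smul_eq_mk_mul, mul_one, y, map_mul, map_sub, map_add]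
  ring

theorem x_transition (W Z : WeierstrassModel R E) :
    W.x = ((W.transition Z).u ^ 2 : K) • Z.x +
      (W.transition Z).r • (1 : E.toAffine.CoordinateRing) := by
  have h : W.transition Z * W.change = Z.change := by simp [transition]
  rw [x_eq, x_eq, ← h]
  generalize W.transition Z = D
  simp only [WeierstrassCurve.VariableChange.mul_def, mul_inv, Units.val_mul,
    Units.val_inv_eq_inv_val]
  match_scalars <;> field_simp
  ring

theorem y_transition (W Z : WeierstrassModel R E) :
    W.y = ((W.transition Z).u ^ 3 : K) • Z.y +
      ((W.transition Z).u ^ 2 * (W.transition Z).s : K) • Z.x +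
      (W.transition Z).t • (1 : E.toAffine.CoordinateRing) := by
  have h : W.transition Z * W.change = Z.change := by simp [transition]
  rw [y_eq, x_eq, y_eq, ← h]
  generalize W.transition Z = D
  simp only [WeierstrassCurve.VariableChange.mul_def, mul_inv, Units.val_mul,
    Units.val_inv_eq_inv_val]
  match_scalars <;> field_simp <;> ring

theorem coordinates_unique {a b c : K} (h : c • CoordinateRing.mk E.toAffine X +
    b • CoordinateRing.mk E.toAffine (C X) + a • (1 : E.toAffine.CoordinateRing) = 0) :
    a = 0 ∧ b = 0 ∧ c = 0 := by
  have := CoordinateRing.smul_basis_eq_zero (W' := E.toAffine) (p := C a + C b * X) (q := C c) (by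
    rw [← h]
    simp only [smul_eq_mk_mul, CoordinateRing.smul, map_add, map_mul, mul_one]
    ring)
  obtain ⟨h1, h2⟩ := this
  refine ⟨by simpa using congrArg (coeff · 0) h1, by simpa using congrArg (coeff · 1) h1,
    by simpa using h2⟩

/-- The functions x, y of a model are triangular in X, Y with nonzero diagonal coefficients, so
independence of 1, X, Y carries over. -/
theorem xy_unique (W : WeierstrassModel R E) {a b c : K}
    (h : c • W.y + b • W.x + a • (1 : E.toAffine.CoordinateRing) = 0) :
    a = 0 ∧ b = 0 ∧ c = 0 := by
  rw [x_eq, y_eq] at h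
  obtain ⟨h1, h2, h3⟩ := coordinates_unique (E := E)
    (c := c * ((W.change.u⁻¹ : Kˣ) : K) ^ 3)
    (b := b * ((W.change.u⁻¹ : Kˣ) : K) ^ 2 - c * ((W.change.u⁻¹ : Kˣ) : K) ^ 3 * W.change.s)
    (a := a - b * ((W.change.u⁻¹ : Kˣ) : K) ^ 2 * W.change.r
      + c * ((W.change.u⁻¹ : Kˣ) : K) ^ 3 * (W.change.s * W.change.r - W.change.t))
    (by rw [← h]; module)
  have hc : c = 0 := by simpa using h3
  subst hc
  have hb : b = 0 := by simpa using h2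
  subst hb
  exact ⟨by simpa using h1, rfl, rfl⟩

theorem mem_L2 {W : WeierstrassModel R E} {f : E.toAffine.CoordinateRing} :
    f ∈ W.L2 ↔ ∃ a b : R, f = b • W.x + a • (1 : E.toAffine.CoordinateRing) := by
  rw [L2, Submodule.mem_span_pair]
  exact exists₂_congr fun a b ↦ by rw [eq_comm, add_comm]

theorem mem_L3 {W : WeierstrassModel R E} {f : E.toAffine.CoordinateRing} :
    f ∈ W.L3 ↔ ∃ a b c : R,
      f = c • W.y + b • W.x + a • (1 : E.toAffine.CoordinateRing) := by
  rw [L3, Submodule.mem_span_triple]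
  exact exists₃_congr fun a b c ↦ by rw [eq_comm, add_comm, add_comm (a • _), add_assoc]

/-- Expanding w, z in x, y and back, and comparing the coefficients of x and of y, shows that the
leading coefficients are units. Only the spanning conditions enter. -/
theorem IsWeierstrassBasis.exists_eq [FaithfulSMul R K] {W : WeierstrassModel R E}
    {w z : E.toAffine.CoordinateRing} (h : W.IsWeierstrassBasis w z) :
    ∃ (ε₁ ε₂ : Rˣ) (c₁ c₂ c₃ : R),
      w = (ε₁ : R) • W.x + c₁ • (1 : E.toAffine.CoordinateRing) ∧
      z = (ε₂ : R) • W.y + c₂ • W.x + c₃ • (1 : E.toAffine.CoordinateRing) := by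
  obtain ⟨h2, h3, -⟩ := h
  have hinj := FaithfulSMul.algebraMap_injective R K
  obtain ⟨c₁, ε, hw⟩ := mem_L2.mp (h2 ▸ Submodule.subset_span (by simp) : w ∈ W.L2)
  obtain ⟨c₃, c₂, η, hz⟩ := mem_L3.mp (h3 ▸ Submodule.subset_span (by simp) : z ∈ W.L3)
  have hx : W.x ∈ Submodule.span R {1, w} := h2 ▸ Submodule.subset_span (by simp)
  have hy : W.y ∈ Submodule.span R {1, w, z} := h3 ▸ Submodule.subset_span (by simp)
  rw [Submodule.mem_span_pair] at hx
  rw [Submodule.mem_span_triple] at hy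
  obtain ⟨a, b, hx⟩ := hx
  obtain ⟨a', b', c', hy⟩ := hy
  have hε : ε * b = 1 := by
    obtain ⟨-, h, -⟩ := W.xy_unique (a := algebraMap R K (a + b * c₁))
      (b := algebraMap R K (b * ε - 1)) (c := 0) (by
        simp only [algebraMap_smul, zero_smul]
        rw [hw] at hx
        exact Eq.trans (by module) (sub_eq_zero.mpr hx))
    rw [map_eq_zero_iff _ hinj] at h
    linear_combination h
  have hη : η * c' = 1 := by
    obtain ⟨-, -, h⟩ := W.xy_unique (a := algebraMap R K (a' + b' * c₁ + c' * c₃))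
      (b := algebraMap R K (b' * ε + c' * c₂)) (c := algebraMap R K (c' * η - 1)) (by
        simp only [algebraMap_smul]
        rw [hw, hz] at hy
        exact Eq.trans (by module) (sub_eq_zero.mpr hy))
    rw [map_eq_zero_iff _ hinj] at h
    linear_combination h
  exact ⟨Units.mkOfMulEqOne ε b hε, Units.mkOfMulEqOne η c' hη, c₁, c₂, c₃, hw, hz⟩

end Coordinates

end WeierstrassModel

/-! ### Galois action on functions and descent of invariant functions to `K`. -/

section GaloisAction

variable {K L : Type*} [Field K] [Field L] [Algebra K L] (E : WeierstrassCurve K)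

theorem galoisAct_mk (g : L ≃ₐ[K] L) (P : L[X][X]) :
    galoisAct E g (CoordinateRing.mk (E.map (algebraMap K L)).toAffine P) =
      CoordinateRing.mk (E.map (algebraMap K L)).toAffine (P.map (mapRingHom (g : L →+* L))) := by
  rw [galoisAct, AdjoinRoot.map]
  rw [CoordinateRing.mk, AdjoinRoot.lift_mk, ← eval₂_map]
  exact AdjoinRoot.aeval_eq _

theorem galoisAct_pullback (g : L ≃ₐ[K] L) (f : E.toAffine.CoordinateRing) :
    galoisAct E g (pullback L E f) = pullback L E f := by
  obtain ⟨P, rfl⟩ := AdjoinRoot.mk_surjective f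
  rw [pullback, CoordinateRing.map_mk, galoisAct_mk, Polynomial.map_map]
  congr 2
  ext <;> simp

theorem galoisAct_smul (g : L ≃ₐ[K] L) (a : L)
    (f : (E.map (algebraMap K L)).toAffine.CoordinateRing) :
    galoisAct E g (a • f) = g a • galoisAct E g f := by
  rw [WeierstrassModel.smul_eq_mk_mul, map_mul, galoisAct_mk, WeierstrassModel.smul_eq_mk_mul]
  simp

theorem pullback_smul (a : K) (f : E.toAffine.CoordinateRing) :
    pullback L E (a • f) = algebraMap K L a • pullback L E f := by
  rw [WeierstrassModel.smul_eq_mk_mul, map_mul, pullback, CoordinateRing.map_mk,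
    WeierstrassModel.smul_eq_mk_mul]
  simp

end GaloisAction

namespace WeierstrassModel

variable {OK K OL L : Type*} [CommRing OK] [Field K] [Algebra OK K] [Field L] [Algebra K L]
  [CommRing OL] [Algebra OK OL] [Algebra OL L] [Algebra OK L]
  [IsScalarTower OK K L] [IsScalarTower OK OL L] {E : WeierstrassCurve K}

variable (OL L) in
theorem pullback_x (W : WeierstrassModel OK E) : pullback L E W.x = (W.baseChange OL L).x := by
  rw [x, pullback, CoordinateRing.map_mk, x]
  congr 1
  simp [baseChange]

variable (OL L) in
theorem pullback_y (W : WeierstrassModel OK E) : pullback L E W.y = (W.baseChange OL L).y := by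
  rw [y, pullback, CoordinateRing.map_mk, y]
  congr 1
  simp [baseChange]

variable {W : WeierstrassModel OK E} {W' : WeierstrassModel OL (E.map (algebraMap K L))}
  {v ρ σ τ : OL}

theorem IsTransition.pullback_x (h : W.IsTransition W' v ρ σ τ) : pullback L E W.x =
    v ^ 2 • W'.x + ρ • (1 : (E.map (algebraMap K L)).toAffine.CoordinateRing) := by
  obtain ⟨hu, hr, -, -⟩ := h
  rw [WeierstrassModel.pullback_x OL L, x_transition _ W', ← hu, ← hr, ← map_pow, algebraMap_smul,
    algebraMap_smul]

theorem IsTransition.pullback_y (h : W.IsTransition W' v ρ σ τ) : pullback L E W.y =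
    v ^ 3 • W'.y + (v ^ 2 * σ) • W'.x +
      τ • (1 : (E.map (algebraMap K L)).toAffine.CoordinateRing) := by
  obtain ⟨hu, -, hs, ht⟩ := h
  rw [WeierstrassModel.pullback_y OL L, y_transition _ W', ← hu, ← hs, ← ht, ← map_pow, ← map_pow,
    ← map_mul, algebraMap_smul, algebraMap_smul, algebraMap_smul]

theorem pullback_smul_OK (L : Type*) [Field L] [Algebra K L] [Algebra OK L] [IsScalarTower OK K L]
    (E : WeierstrassCurve K) (a : OK) (f : E.toAffine.CoordinateRing) :
    pullback L E (a • f) = a • pullback L E f := by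
  rw [← algebraMap_smul K a f, pullback_smul, ← IsScalarTower.algebraMap_apply, algebraMap_smul]

/-- A Galois-invariant linear combination of `1` and the coordinates of a model over `OK` has its
coefficients in `K`. -/
theorem exists_of_galoisAct_eq [FiniteDimensional K L] [IsGalois K L] (W : WeierstrassModel OK E)
    {a b c : L} (h : ∀ g : L ≃ₐ[K] L, galoisAct E g
      (c • pullback L E W.y + b • pullback L E W.x +
        a • (1 : (E.map (algebraMap K L)).toAffine.CoordinateRing)) =
      c • pullback L E W.y + b • pullback L E W.x +
        a • (1 : (E.map (algebraMap K L)).toAffine.CoordinateRing)) :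
    ∃ a₀ b₀ c₀ : K, algebraMap K L a₀ = a ∧ algebraMap K L b₀ = b ∧ algebraMap K L c₀ = c := by
  have key (g : L ≃ₐ[K] L) : g a = a ∧ g b = b ∧ g c = c := by
    have hg := h g
    simp only [map_add, galoisAct_smul, galoisAct_pullback, map_one] at hg
    -- The choice of ring is immaterial: it only lets the pullbacks be viewed as coordinates of some
    -- model over L, so that coefficients are unique.
    rw [WeierstrassModel.pullback_x (integralClosure OK L) L,
      WeierstrassModel.pullback_y (integralClosure OK L) L] at hg
    obtain ⟨h1, h2, h3⟩ := (W.baseChange (integralClosure OK L) L).xy_unique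
      (a := g a - a) (b := g b - b) (c := g c - c)
      (Eq.trans (by module) (sub_eq_zero.mpr hg))
    exact ⟨sub_eq_zero.mp h1, sub_eq_zero.mp h2, sub_eq_zero.mp h3⟩
  obtain ⟨a₀, ha⟩ := (IsGalois.mem_range_algebraMap_iff_fixed a).mpr fun g ↦ (key g).1
  obtain ⟨b₀, hb⟩ := (IsGalois.mem_range_algebraMap_iff_fixed b).mpr fun g ↦ (key g).2.1
  obtain ⟨c₀, hc⟩ := (IsGalois.mem_range_algebraMap_iff_fixed c).mpr fun g ↦ (key g).2.2
  exact ⟨a₀, b₀, c₀, ha, hb, hc⟩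

/-- The coefficients of a Galois-invariant function with integral coefficients with respect to
`W'`, when it is written in the coordinates of `W`. -/
theorem IsTransition.exists_of_galoisAct_eq [FiniteDimensional K L] [IsGalois K L]
    (h : W.IsTransition W' v ρ σ τ) {f : (E.map (algebraMap K L)).toAffine.CoordinateRing}
    {k₁ k₂ k₃ : OL} (hf : f = k₃ • W'.y + k₂ • W'.x +
      k₁ • (1 : (E.map (algebraMap K L)).toAffine.CoordinateRing))
    (hg : ∀ g : L ≃ₐ[K] L, galoisAct E g f = f) :
    ∃ γ α β : K,
      f = pullback L E (γ • W.y + α • W.x + β • (1 : E.toAffine.CoordinateRing)) ∧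
      algebraMap OL L k₃ = algebraMap K L γ * algebraMap OL L v ^ 3 ∧
      algebraMap OL L k₂ =
        (algebraMap K L γ * algebraMap OL L σ + algebraMap K L α) * algebraMap OL L v ^ 2 ∧
      algebraMap OL L k₁ = algebraMap K L γ * algebraMap OL L τ +
        algebraMap K L α * algebraMap OL L ρ + algebraMap K L β := by
  have hv : algebraMap OL L v ≠ 0 := by rw [h.1]; exact Units.ne_zero _
  have hx := h.pullback_x
  have hy := h.pullback_y
  set v' := algebraMap OL L v with hv'
  -- These solve the triangular substitution for the coefficients of f in the coordinates of `W`.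
  set c := algebraMap OL L k₃ / v' ^ 3 with hc
  set b := algebraMap OL L k₂ / v' ^ 2 - c * algebraMap OL L σ with hb
  set a := algebraMap OL L k₁ - c * algebraMap OL L τ - b * algebraMap OL L ρ with ha
  have e3 : algebraMap OL L k₃ = c * v' ^ 3 := by rw [hc]; field_simp
  have e2 : algebraMap OL L k₂ = (c * algebraMap OL L σ + b) * v' ^ 2 := by
    rw [hb]; field_simp; ring
  have e1 : algebraMap OL L k₁ = c * algebraMap OL L τ + b * algebraMap OL L ρ + a := by
    rw [ha]; ring
  have hf' : f = c • pullback L E W.y + b • pullback L E W.x +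
      a • (1 : (E.map (algebraMap K L)).toAffine.CoordinateRing) := by
    rw [hf, hx, hy]
    simp only [← algebraMap_smul L (_ : OL), map_mul, map_pow, e1, e2, e3, ← hv']
    module
  obtain ⟨β, α, γ, hβ, hα, hγ⟩ := W.exists_of_galoisAct_eq (a := a) (b := b) (c := c)
    (fun g ↦ by rw [← hf']; exact hg g)
  refine ⟨γ, α, β, ?_, by rw [hγ, e3], by rw [hγ, hα, e2], by rw [hγ, hα, hβ, e1]⟩
  rw [hf', map_add, map_add, pullback_smul, pullback_smul, pullback_smul, map_one, hα, hβ, hγ]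

end WeierstrassModel

theorem ordAt_algebraMap_eq_mul {OK OL : Type*} [CommRing OK] [IsDomain OK]
    [IsDiscreteValuationRing OK] [CommRing OL] [Algebra OK OL] [IsDedekindDomain OL]
    [Module.IsTorsionFree OK OL] (p : Ideal OL) [p.IsPrime] (hp0 : p ≠ ⊥) {π : OK}
    (hπ : Irreducible π) {a : OK} (ha : a ≠ 0) :
    ordAt p (algebraMap OK OL a) =
      ordAt (IsLocalRing.maximalIdeal OK) a * ordAt p (algebraMap OK OL π) := by
  have hm0 := IsDiscreteValuationRing.not_a_field OK
  obtain ⟨j, u, rfl⟩ := IsDiscreteValuationRing.eq_unit_mul_pow_irreducible ha hπ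
  have hπ0 : algebraMap OK OL π ≠ 0 :=
    (map_ne_zero_iff _ (FaithfulSMul.algebraMap_injective OK OL)).mpr hπ.ne_zero
  have hu := u.isUnit.map (algebraMap OK OL)
  have hππ : ordAt (IsLocalRing.maximalIdeal OK) π = 1 := by
    rw [ordAt, ← hπ.maximalIdeal_eq]
    exact multiplicity_self
  rw [map_mul, map_pow, ordAt_mul hp0 hu.ne_zero (pow_ne_zero _ hπ0), ordAt_of_isUnit hu,
    ordAt_pow hp0 hπ0, ordAt_mul hm0 u.ne_zero (pow_ne_zero _ hπ.ne_zero),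
    ordAt_of_isUnit u.isUnit, ordAt_pow hm0 hπ.ne_zero, hππ]
  ring

/-! ### The comparison theorem. -/

theorem theorem4 {OK K OL L : Type*}
    -- a discrete valuation ring `OK` with field of fractions `K`
    [CommRing OK] [IsDomain OK] [IsDiscreteValuationRing OK] [Field K] [Algebra OK K]
    [IsFractionRing OK K]
    -- a finite Galois extension `L / K`
    [Field L] [Algebra K L] [FiniteDimensional K L] [IsGalois K L]
    -- the integral closure `OL` of `OK` in `L`
    [CommRing OL] [Algebra OK OL] [Algebra OL L] [Algebra OK L]
    [IsScalarTower OK K L] [IsScalarTower OK OL L] [IsIntegralClosure OL OK L]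
    [IsDedekindDomain OL] [Module.IsTorsionFree OK OL]
    -- an elliptic curve `E` over `K` and the minimal Weierstrass models of `E` and of `E_L`
    (E : WeierstrassCurve K) [E.IsElliptic]
    (W : WeierstrassModel OK E) (hW : W.IsMinimal)
    (W' : WeierstrassModel OL (E.map (algebraMap K L))) (hW' : W'.IsMinimal)
    -- a maximal ideal of `OL`
    (p : Ideal OL) [p.IsMaximal] :
    -- the comparison of the discriminants
    (0 ≤ (ordAt p (algebraMap OK OL W.eqn.Δ) : ℤ) - ordAt p W'.eqn.Δ ∧
      (ordAt p (algebraMap OK OL W.eqn.Δ) : ℤ) - ordAt p W'.eqn.Δ ≤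
        12 * ((differentExponent OK p : ℤ) + p.ramificationIdx OK - 1)) ∧
    -- the comparison of the Weierstrass bases
    (∀ x y x' y', W.IsWeierstrassBasis x y → W'.IsWeierstrassBasis x' y' →
      ∃ b₁ b₂ b₃ b₄ b₅ : OL,
        pullback L E x = b₁ • x' + b₂ • 1 ∧
        pullback L E y = b₃ • y' + b₄ • x' + b₅ • 1 ∧
        b₁ ≠ 0 ∧ b₃ ≠ 0 ∧
        (ordAt p b₁ : ℤ) ≤ 2 * ((differentExponent OK p : ℤ) + p.ramificationIdx OK - 1) ∧
        (ordAt p b₃ : ℤ) ≤ 3 * ((differentExponent OK p : ℤ) + p.ramificationIdx OK - 1)) ∧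
    -- `L(nε)` is contained in `L(nε')^G` for `n = 2, 3`, and the quotients are annihilated by
    -- explicit powers of a uniformizing element
    (pullback L E '' W.L2 ⊆ galoisInvariants E W'.L2 ∧
      pullback L E '' W.L3 ⊆ galoisInvariants E W'.L3 ∧
      ∀ π : OK, Irreducible π →
        (∀ f ∈ galoisInvariants E W'.L2,
          π ^ (2 * ⌊(differentExponent OK p : ℚ) / p.ramificationIdx OK⌋₊ + 3) • f ∈
            pullback L E '' W.L2) ∧
        (∀ f ∈ galoisInvariants E W'.L3,
          π ^ (2 * ⌊(differentExponent OK p : ℚ) / p.ramificationIdx OK⌋₊ + 4) • f ∈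
            pullback L E '' W.L3)) ∧
    -- the bound in the case of good reduction over `L`
    (W'.eqn.IsElliptic →
      (ordAt (IsLocalRing.maximalIdeal OK) W.eqn.Δ : ℤ) ≤
        ⌊12 * ((differentExponent OK p : ℚ) - 1) / p.ramificationIdx OK⌋ + 12) := by
  have := IsIntegralClosure.isFractionRing_of_finite_extension OK K L OL
  have : Module.Finite OK OL := IsIntegralClosure.finite OK K L OL
  have : p.LiesOver (IsLocalRing.maximalIdeal OK) := liesOver_maximalIdeal_of_isIntegral p
  have hp0 : p ≠ ⊥ := ne_bot_of_liesOver_maximalIdeal (OK := OK) p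
  have hinj := IsFractionRing.injective OL L
  obtain ⟨v, ρ, σ, τ, hDu, hDr, hDs, hDt, hG⟩ := W.exists_galoisCompatible_transition W' hW'
  have hD : W.IsTransition W' v ρ σ τ := ⟨hDu, hDr, hDs, hDt⟩
  have hv0 := hD.ne_zero
  have he : 0 < p.ramificationIdx OK := Ideal.ramificationIdx_pos p OK
  have hord (ϖ : OK) (hϖ : Irreducible ϖ) :
      ordAt p (algebraMap OK OL ϖ) = p.ramificationIdx OK := ordAt_algebraMap p hϖ
  obtain ⟨ϖ, hϖ⟩ := IsDiscreteValuationRing.exists_irreducible OK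
  have hn := hW.ordAt_transition_lt hD hG hϖ hp0 (by rw [hord ϖ hϖ]; exact he)
  rw [hord ϖ hϖ] at hn
  have hΔ : algebraMap OK OL W.eqn.Δ = v ^ 12 * W'.eqn.Δ := by
    apply hinj
    have h := (W.baseChange OL L).algebraMap_Δ_transition W'
    rw [← hDu, ← map_pow, ← map_mul] at h
    rw [← h, WeierstrassModel.baseChange, WeierstrassCurve.map_Δ]
  have hΔord : ordAt p (algebraMap OK OL W.eqn.Δ) = 12 * ordAt p v + ordAt p W'.eqn.Δ := by
    rw [hΔ, ordAt_mul hp0 (pow_ne_zero _ hv0) W'.Δ_ne_zero, ordAt_pow hp0 hv0]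
  have hx := hD.pullback_x
  have hy := hD.pullback_y
  refine ⟨⟨by omega, by omega⟩, ?_, ⟨?_, ?_, ?_⟩, ?_⟩
  · intro x y x' y' hxy hxy'
    obtain ⟨ε₁, ε₂, c₁, c₂, c₃, rfl, rfl⟩ := hxy.exists_eq
    obtain ⟨η₁, η₂, d₁, d₂, d₃, rfl, rfl⟩ := hxy'.exists_eq
    have hη₁ : ((η₁⁻¹ : OLˣ) : OL) * η₁ = 1 := η₁.inv_mul
    have hη₂ : ((η₂⁻¹ : OLˣ) : OL) * η₂ = 1 := η₂.inv_mul
    generalize hi₁ : ((η₁⁻¹ : OLˣ) : OL) = i₁ at hη₁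
    generalize hi₂ : ((η₂⁻¹ : OLˣ) : OL) = i₂ at hη₂
    have hu₁ : IsUnit (algebraMap OK OL ε₁ * i₁) :=
      (ε₁.isUnit.map _).mul (hi₁ ▸ Units.isUnit _)
    have hu₂ : IsUnit (algebraMap OK OL ε₂ * i₂) :=
      (ε₂.isUnit.map _).mul (hi₂ ▸ Units.isUnit _)
    have hord₁ : ordAt p (algebraMap OK OL ε₁ * i₁ * v ^ 2) = 2 * ordAt p v := by
      rw [ordAt_mul hp0 hu₁.ne_zero (pow_ne_zero _ hv0), ordAt_of_isUnit hu₁, ordAt_pow hp0 hv0,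
        zero_add]
    have hord₂ : ordAt p (algebraMap OK OL ε₂ * i₂ * v ^ 3) = 3 * ordAt p v := by
      rw [ordAt_mul hp0 hu₂.ne_zero (pow_ne_zero _ hv0), ordAt_of_isUnit hu₂, ordAt_pow hp0 hv0,
        zero_add]
    have hx' : W'.x = i₁ • ((η₁ : OL) • W'.x + d₁ • 1) - (i₁ * d₁) • 1 := by
      rw [smul_add, smul_smul, hη₁]; module
    have hy' : W'.y = i₂ • ((η₂ : OL) • W'.y + d₂ • W'.x + d₃ • 1) - (i₂ * d₂) • W'.x
        - (i₂ * d₃) • 1 := by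
      rw [smul_add, smul_add, smul_smul, hη₂]; module
    generalize (η₁ : OL) • W'.x + d₁ • 1 = x' at *
    generalize (η₂ : OL) • W'.y + d₂ • W'.x + d₃ • 1 = y' at *
    -- These come from expanding the given bases in the coordinates of `W` and `W'` and substituting
    -- the transition. The leading coefficients are v² and v³ up to units.
    refine ⟨algebraMap OK OL ε₁ * i₁ * v ^ 2,
      algebraMap OK OL ε₁ * (ρ - v ^ 2 * (i₁ * d₁)) + algebraMap OK OL c₁,
      algebraMap OK OL ε₂ * i₂ * v ^ 3,
      (algebraMap OK OL ε₂ * (v ^ 2 * σ - v ^ 3 * (i₂ * d₂)) + algebraMap OK OL c₂ * v ^ 2) * i₁,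
      algebraMap OK OL ε₂ * (τ - v ^ 3 * (i₂ * d₃)) + algebraMap OK OL c₂ * ρ +
        algebraMap OK OL c₃ - (algebraMap OK OL ε₂ * (v ^ 2 * σ - v ^ 3 * (i₂ * d₂)) +
          algebraMap OK OL c₂ * v ^ 2) * (i₁ * d₁),
      ?_, ?_, mul_ne_zero hu₁.ne_zero (pow_ne_zero _ hv0),
      mul_ne_zero hu₂.ne_zero (pow_ne_zero _ hv0), by omega, by omega⟩
    · simp only [map_add, WeierstrassModel.pullback_smul_OK, map_one, hx]
      simp only [← algebraMap_smul OL (_ : OK)]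
      rw [hx']
      module
    · simp only [map_add, WeierstrassModel.pullback_smul_OK, map_one, hx, hy]
      simp only [← algebraMap_smul OL (_ : OK)]
      rw [hy', hx']
      module
  · rintro _ ⟨f, hf, rfl⟩
    refine ⟨?_, fun g ↦ galoisAct_pullback E g f⟩
    obtain ⟨a, b, rfl⟩ := WeierstrassModel.mem_L2.mp hf
    refine WeierstrassModel.mem_L2.mpr
      ⟨algebraMap OK OL b * ρ + algebraMap OK OL a, algebraMap OK OL b * v ^ 2, ?_⟩
    simp only [map_add, WeierstrassModel.pullback_smul_OK, map_one, hx]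
    simp only [← algebraMap_smul OL (_ : OK)]
    module
  · rintro _ ⟨f, hf, rfl⟩
    refine ⟨?_, fun g ↦ galoisAct_pullback E g f⟩
    obtain ⟨a, b, c, rfl⟩ := WeierstrassModel.mem_L3.mp hf
    refine WeierstrassModel.mem_L3.mpr
      ⟨algebraMap OK OL c * τ + algebraMap OK OL b * ρ + algebraMap OK OL a,
        algebraMap OK OL c * (v ^ 2 * σ) + algebraMap OK OL b * v ^ 2,
        algebraMap OK OL c * v ^ 3, ?_⟩
    simp only [map_add, WeierstrassModel.pullback_smul_OK, map_one, hx, hy]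
    simp only [← algebraMap_smul OL (_ : OK)]
    module
  · intro π hπ
    set q := ⌊(differentExponent OK p : ℚ) / p.ramificationIdx OK⌋₊ with hqdef
    have hq : differentExponent OK p < (q + 1) * p.ramificationIdx OK := by
      have h := Nat.lt_floor_add_one ((differentExponent OK p : ℚ) / p.ramificationIdx OK)
      rw [← hqdef, div_lt_iff₀ (by exact_mod_cast he)] at h
      exact_mod_cast h
    have he' : 0 < ordAt p (algebraMap OK OL π) := by rw [hord π hπ]; exact he
    have hπ0 : algebraMap OK OL π ≠ 0 :=
      (map_ne_zero_iff _ (FaithfulSMul.algebraMap_injective OK OL)).mpr hπ.ne_zero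
    constructor
    · rintro f ⟨hf, hfg⟩
      obtain ⟨k₁, k₂, hf⟩ := WeierstrassModel.mem_L2.mp hf
      obtain ⟨γ, α, β, hf, h₃, h₂, h₁⟩ := hD.exists_of_galoisAct_eq (k₃ := 0) (k₂ := k₂) (k₁ := k₁)
        (by rw [hf, zero_smul, zero_add]) hfg
      have hγ : γ = 0 := by
        rw [map_zero, eq_comm, mul_eq_zero] at h₃
        exact (map_eq_zero _).mp (h₃.resolve_right
          (pow_ne_zero _ ((map_ne_zero_iff _ hinj).mpr hv0)))
      subst hγ
      rw [map_zero, zero_mul, zero_add] at h₂ h₁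
      -- If π^(2q+4) divided v², then n ≥ (q+2)e > d + e, against the bound on n.
      obtain ⟨a, ha⟩ := exists_pow_mul_eq_of_not_dvd (M := 2 * q + 3) hπ h₂ (fun hdvd ↦ by
        have h := ordAt_le_of_dvd hp0 (pow_ne_zero _ hv0) hdvd
        rw [ordAt_pow hp0 hv0, ordAt_pow hp0 hπ0, hord π hπ] at h
        nlinarith)
      have hb : algebraMap OL L (algebraMap OK OL π ^ (2 * q + 3) * k₁ - algebraMap OK OL a * ρ) =
          algebraMap K L (algebraMap OK K π ^ (2 * q + 3) * β) := by
        have haL := congrArg (algebraMap K L) ha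
        simp only [map_mul, map_sub, map_pow, ← IsScalarTower.algebraMap_apply OK K L,
          ← IsScalarTower.algebraMap_apply OK OL L] at haL ⊢
        rw [h₁, haL]
        ring
      obtain ⟨b, hb⟩ := exists_algebraMap_eq_of_isIntegralClosure OK hb
      refine ⟨a • W.x + b • 1, WeierstrassModel.mem_L2.mpr ⟨b, a, rfl⟩, ?_⟩
      rw [hf, ← WeierstrassModel.pullback_smul_OK]
      congr 1
      simp only [← algebraMap_smul K (_ : OK), ha, hb, map_pow]
      module
    · rintro f ⟨hf, hfg⟩
      obtain ⟨k₁, k₂, k₃, hf⟩ := WeierstrassModel.mem_L3.mp hf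
      obtain ⟨γ, α, β, hf, h₃, h₂, h₁⟩ := hD.exists_of_galoisAct_eq hf hfg
      obtain ⟨c, hc⟩ := hW.exists_pow_mul_eq hD hG hπ hp0 he' h₃ h₂ h₁
        (by rw [hord π hπ]; exact hq)
      obtain ⟨⟨a, ha⟩, b, hb⟩ := exists_pow_mul_eq_of_leading
        ((hG.dvd_of_ordAt_le hv0 hπ hp0 he' (2 * q + 4) 2).2 (by rw [hord π hπ]; nlinarith))
        h₂ h₁ hc
      refine ⟨c • W.y + a • W.x + b • 1, WeierstrassModel.mem_L3.mpr ⟨b, a, c, rfl⟩, ?_⟩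
      rw [hf, ← WeierstrassModel.pullback_smul_OK]
      congr 1
      simp only [← algebraMap_smul K (_ : OK), ha, hb, hc, map_pow]
      module
  · intro hell
    have h0 : ordAt p W'.eqn.Δ = 0 := ordAt_of_isUnit W'.eqn.isUnit_Δ
    rw [h0, ordAt_algebraMap_eq_mul p hp0 hϖ W.Δ_ne_zero, hord ϖ hϖ, add_zero] at hΔord
    -- The summand 12 is absorbed before removing the floor: 12(d - 1)/e + 12 = 12(d + e - 1)/e, and
    -- 12n is e times the valuation of Δ(W).
    rw [← sub_le_iff_le_add, Int.le_floor, le_div_iff₀ (by exact_mod_cast he)]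
    have h1 : (ordAt (IsLocalRing.maximalIdeal OK) W.eqn.Δ : ℤ) * p.ramificationIdx OK ≤
        12 * ((differentExponent OK p : ℤ) + p.ramificationIdx OK - 1) := by
      zify at hΔord hn
      rw [hΔord]
      linarith
    have h2 : (ordAt (IsLocalRing.maximalIdeal OK) W.eqn.Δ : ℚ) * p.ramificationIdx OK ≤
        12 * ((differentExponent OK p : ℚ) + p.ramificationIdx OK - 1) := by exact_mod_cast h1
    push_cast
    linarith
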